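/- There is a family of real constants $(C_\varepsilon)_{\varepsilon>0}$ such that the following holds. Let $p$ be a prime and let $P\subseteq\mathbb{F}_p^2$ be any set of points with $|P|<p$. Write $L(P)$ for the set of lines in $\mathbb{F}_p^2$ that pass through at least two distinct points of $P$. Then at least one of the following occurs: 1. there is a line $\ell$ in $\mathbb{F}_p^2$ such that $|P|\le C_\varepsilon\,|P\cap\ell|^{1+\varepsilon}$ for all $\varepsilon>0$ (that is, $\widetilde\Omega(|P|)$ points of $P$ lie on a single line); 2. $|P|^{1+\frac1{133}}\le C_\varepsilon\,|L(P)|^{1+\varepsilon}$ for all $\varepsilon>0$ (that is, $|L(P)|\gtrsim|P|^{1+\frac1{133}}$). Here each $C_\varepsilon$ depends only on $\varepsilon$, and not on $p$ or $P$. -/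

import Mathlib

/-- A line in the affine plane `F × F`: an affine subspace of dimension one. -/
def IsPlaneLine {F : Type*} [Field F] (l : AffineSubspace F (F × F)) : Prop :=
  Module.finrank F l.direction = 1

open Classical in
/-- `L(P)`: the set of lines through two distinct points of `P`. -/
noncomputable def linesDetermined {F : Type*} [Field F] (P : Finset (F × F)) :
    Finset (AffineSubspace F (F × F)) :=
  P.offDiag.image fun q => affineSpan F {q.1, q.2}

open Classical in
/-- The points of `P` that lie on `l`. -/
noncomputable def pointsOn {F : Type*} [Field F] (P : Finset (F × F))
    (l : AffineSubspace F (F × F)) : Finset (F × F) :=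
  P.filter fun x => x ∈ l

/-- `Y ≲ X` (equivalently `Y = Õ(X)`, or `X = Ω̃(Y)`) with implicit constants `C`:
for every `ε > 0` one has `Y ≤ C_ε X ^ (1 + ε)`. -/
def LesssimWith (C : ℝ → ℝ) (Y X : ℝ) : Prop :=
  ∀ ε : ℝ, 0 < ε → Y ≤ C ε * X ^ (1 + ε)

/-! Write N = |P| and L = |L(P)|, and suppose that no line holds half of P. Cauchy–Schwarz for
incidences yields a line carrying ≳ N/√L points of P, each on only O(√L) determined lines
(`exists_line_many_points_small_degree`). Send that line to infinity: the pencils through these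
points become families of parallel lines. The remaining points of P form a set G of at least N/2
points whose two coordinate projections, and whose sums a + c * b for ≳ N/√L values c ∈ Λ, all have
size at most T = O(√L) (`exists_graph_few_sums`).

When L is close to N, G is dense in the product of its projections. A Balog–Szemerédi–Gowers
argument then gives a single large B, independent of c, with cB - c'B small for all c, c' ∈ Λ
(`exists_set_small_dilate_differences`). Plünnecke's inequality passes from this to B + mB being
small for every slope m of Λ × Λ (`card_add_dilate_le`).

On the other hand Λ × Λ has ≳ |Λ|² slopes (`card_mul_lt_card_slopes`, by Rédei polynomials; |P| < p
serves to ensure |Λ|² ≤ p), and averaging collisions over that many m shows that some B + mB is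
large (`exists_large_image`). Comparing the two bounds gives N^74 ≪ L^73, which is stronger than the
exponent 1 + 1/133 and loses no ε. -/

/-! ### Slopes of a Cartesian square, by Rédei polynomials -/

section Slopes

open Polynomial

/-- The bivariate polynomial `f` has total degree at most `n`. -/
def TotalDegreeLE {R : Type*} [CommRing R] (n : ℕ) (f : R[X][X]) : Prop :=
  ∀ i j, n < i + j → (f.coeff i).coeff j = 0

namespace TotalDegreeLE

variable {R : Type*} [CommRing R]

theorem mul {m n : ℕ} {f g : R[X][X]} (hf : TotalDegreeLE m f) (hg : TotalDegreeLE n g) :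
    TotalDegreeLE (m + n) (f * g) := by
  intro i j hij
  rw [coeff_mul, finsetSum_coeff]
  refine Finset.sum_eq_zero fun x hx => ?_
  rw [coeff_mul]
  refine Finset.sum_eq_zero fun y hy => ?_
  rw [Finset.HasAntidiagonal.mem_antidiagonal] at hx hy
  by_cases h : m < x.1 + y.1
  · rw [hf _ _ h, zero_mul]
  · rw [hg _ _ (by omega), mul_zero]

theorem sub {n : ℕ} {f g : R[X][X]} (hf : TotalDegreeLE n f) (hg : TotalDegreeLE n g) :
    TotalDegreeLE n (f - g) := by
  intro i j hij
  rw [coeff_sub, coeff_sub, hf i j hij, hg i j hij, sub_zero]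

theorem one : TotalDegreeLE 0 (1 : R[X][X]) := by
  intro i j hij
  rw [coeff_one]
  split_ifs with h
  · rw [coeff_one, if_neg (by omega)]
  · simp

theorem X : TotalDegreeLE 1 (X : R[X][X]) := by
  intro i j hij
  rw [coeff_X]
  split_ifs with h
  · rw [coeff_one, if_neg (by omega)]
  · simp

theorem X_sub_C_linear (a b : R) :
    TotalDegreeLE 1 (Polynomial.X - C (C b - C a * Polynomial.X) : R[X][X]) := by
  refine X.sub fun i j hij => ?_
  rw [coeff_C]
  split_ifs with h
  · rw [coeff_sub, coeff_C, if_neg (by omega), coeff_C_mul, coeff_X, if_neg (by omega)]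
    simp
  · simp

theorem prod {ι : Type*} (s : Finset ι) (f : ι → R[X][X])
    (hf : ∀ i ∈ s, TotalDegreeLE 1 (f i)) : TotalDegreeLE s.card (∏ i ∈ s, f i) := by
  classical
  induction s using Finset.induction_on with
  | empty => simpa using one
  | insert a s ha ih =>
    rw [Finset.prod_insert ha, Finset.card_insert_of_notMem ha, add_comm]
    exact (hf a (Finset.mem_insert_self _ _)).mul
      (ih fun i hi => hf i (Finset.mem_insert_of_mem hi))

/-- Division of a power of `X` by a monic polynomial respects the total degree. -/
theorem exists_X_pow_eq [Nontrivial R] {Q : R[X][X]} {k : ℕ} (hk : 0 < k) (hQ : Q.Monic)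
    (hdeg : Q.natDegree = k) (hW : TotalDegreeLE k Q) (n : ℕ) :
    ∃ q r : R[X][X], Polynomial.X ^ n = Q * q + r ∧ r.degree < k ∧ TotalDegreeLE n r := by
  induction n with
  | zero =>
    refine ⟨0, 1, by simp, ?_, one⟩
    rw [degree_one]
    exact_mod_cast hk
  | succ n ih =>
    obtain ⟨q, r, h, hr, hWr⟩ := ih
    -- `X * r` can reach degree k only through `r.coeff (k - 1)`, so one multiple of the monic `Q`
    -- cancels the excess. That coefficient has degree at most n - (k - 1) in the inner variable, so
    -- the total degree grows by only one.
    refine ⟨Polynomial.X * q + C (r.coeff (k - 1)), Polynomial.X * r - C (r.coeff (k - 1)) * Q,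
      ?_, ?_, ?_⟩
    · rw [pow_succ, h]; ring
    · rw [degree_lt_iff_coeff_zero] at hr ⊢
      intro m hm
      rw [coeff_sub, coeff_C_mul]
      obtain ⟨m, rfl⟩ : ∃ m', m = m' + 1 := ⟨m - 1, by omega⟩
      rw [coeff_X_mul]
      rcases hm.eq_or_lt with h1 | h1
      · have : Q.coeff (m + 1) = 1 := by rw [← h1, ← hdeg]; exact hQ
        rw [this, mul_one, h1]; simp
      · rw [coeff_eq_zero_of_natDegree_lt (by omega : Q.natDegree < m + 1), mul_zero, sub_zero]
        exact hr m (by omega)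
    · refine sub ?_ ?_
      · rw [add_comm]; exact X.mul hWr
      · intro i j hij
        rw [coeff_C_mul, coeff_mul]
        refine Finset.sum_eq_zero fun y hy => ?_
        rw [Finset.HasAntidiagonal.mem_antidiagonal] at hy
        by_cases h : n < k - 1 + y.1
        · rw [hWr _ _ h, zero_mul]
        · rw [hW _ _ (by omega), mul_zero]

end TotalDegreeLE

/-- The finite slopes determined by the Cartesian square of `D`. -/
def slopes {F : Type*} [Field F] [DecidableEq F] (D : Finset F) : Finset F :=
  (D.offDiag ×ˢ D ×ˢ D).image fun q => (q.2.1 - q.2.2) / (q.1.1 - q.1.2)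

theorem mem_slopes {F : Type*} [Field F] [DecidableEq F] {D : Finset F} {m : F} :
    m ∈ slopes D ↔ ∃ x₁ ∈ D, ∃ x₂ ∈ D, ∃ y₁ ∈ D, ∃ y₂ ∈ D, x₁ ≠ x₂ ∧
      (y₁ - y₂) / (x₁ - x₂) = m := by
  simp only [slopes, Finset.mem_image, Finset.mem_product, Finset.mem_offDiag, Prod.exists]
  constructor
  · rintro ⟨x₁, x₂, y₁, y₂, ⟨⟨h1, h2, h3⟩, h4, h5⟩, h⟩
    exact ⟨x₁, h1, x₂, h2, y₁, h4, y₂, h5, h3, h⟩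
  · rintro ⟨x₁, h1, x₂, h2, y₁, h4, y₂, h5, h3, h⟩
    exact ⟨x₁, x₂, y₁, y₂, ⟨⟨h1, h2, h3⟩, h4, h5⟩, h⟩

/-- Two points with equal value of y - x m span a chord of slope m, unless they share x and hence
coincide. -/
theorem injOn_of_notMem_slopes {F : Type*} [Field F] [DecidableEq F] {D : Finset F} {m : F}
    (hm : m ∉ slopes D) :
    Set.InjOn (fun u : F × F => u.2 - u.1 * m) (D ×ˢ D : Finset (F × F)) := by
  rintro ⟨x₁, y₁⟩ h1 ⟨x₂, y₂⟩ h2 h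
  rw [Finset.mem_coe, Finset.mem_product] at h1 h2
  dsimp only at h h1 h2
  by_cases hx : x₁ = x₂
  · subst hx
    simpa using h
  · refine (hm (mem_slopes.2 ⟨x₁, h1.1, x₂, h2.1, y₁, h1.2, y₂, h2.2, hx, ?_⟩)).elim
    rw [div_eq_iff (sub_ne_zero.2 hx)]
    linear_combination h

/-- A non-collinear Cartesian square `D ×ˢ D` with at most `p` points determines at least
`#D * (#D - 1) + 1` finite slopes. -/
theorem card_mul_lt_card_slopes {p : ℕ} [Fact p.Prime] (D : Finset (ZMod p)) (hD : 2 ≤ D.card)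
    (hDp : D.card ^ 2 ≤ p) : D.card * (D.card - 1) < (slopes D).card := by
  set k := D.card with hk
  set ρ := (slopes D).card with hρ
  have hρpos : 0 < ρ := by
    obtain ⟨a, ha, b, hb, hab⟩ := Finset.one_lt_card.1 hD
    exact Finset.card_pos.2 ⟨_, mem_slopes.2 ⟨a, ha, b, hb, a, ha, a, ha, hab, rfl⟩⟩
  have hρp : ρ ≤ p := by simpa using Finset.card_le_univ (slopes D)
  rcases hρp.eq_or_lt with hp | hp
  · rw [hp]
    refine lt_of_lt_of_le ?_ hDp
    rw [sq]
    exact Nat.mul_lt_mul_of_pos_left (by omega) (by omega)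
  -- The Rédei polynomial of the square: the inner variable is the slope m, and specialising it
  -- gives the product of X - (y - x m).
  set Q : (ZMod p)[X][X] := ∏ u ∈ D ×ˢ D, (X - C (C u.2 - C u.1 * X)) with hQ
  have hQm : Q.Monic := monic_prod_of_monic _ _ fun u _ => monic_X_sub_C _
  have hQd : Q.natDegree = k ^ 2 := by
    rw [hQ, natDegree_prod_of_monic _ _ fun u _ => monic_X_sub_C _]
    simp only [natDegree_X_sub_C, Finset.sum_const, Finset.card_product, smul_eq_mul, mul_one]
    rw [← hk, sq]
  have hQW : TotalDegreeLE (k ^ 2) Q := by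
    have := TotalDegreeLE.prod (D ×ˢ D) (fun u => (X - C (C u.2 - C u.1 * X) : (ZMod p)[X][X]))
      fun u _ => TotalDegreeLE.X_sub_C_linear u.1 u.2
    rwa [Finset.card_product, ← sq] at this
  have hk2 : 4 ≤ k ^ 2 := by nlinarith
  obtain ⟨q, r, hqr, hrd, hrW⟩ :=
    TotalDegreeLE.exists_X_pow_eq (by omega) hQm hQd hQW p
  have hmap (m : ZMod p) : (X : (ZMod p)[X]) ^ p
      = (∏ u ∈ D ×ˢ D, (X - C (u.2 - u.1 * m))) * q.map (evalRingHom m)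
        + r.map (evalRingHom m) := by
    have := congrArg (Polynomial.map (evalRingHom m)) hqr
    simpa only [hQ, Polynomial.map_pow, map_X, Polynomial.map_add, Polynomial.map_mul,
      Polynomial.map_prod, Polynomial.map_sub, map_C, coe_evalRingHom, eval_sub, eval_mul, eval_C,
      eval_X] using this
  -- For a non-slope m the roots y - x m are distinct, so the specialised product divides X^p - X,
  -- and the remainder must be X.
  have hgen (m : ZMod p) (hm : m ∉ slopes D) : r.map (evalRingHom m) = X := by
    have hinj := injOn_of_notMem_slopes hm
    have hdvd : (∏ u ∈ D ×ˢ D, (X - C (u.2 - u.1 * m))) ∣ (X : (ZMod p)[X]) ^ p - X := by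
      refine Finset.prod_dvd_of_coprime (fun u hu v hv huv => ?_) fun u _ => ?_
      · exact pairwise_coprime_X_sub_C (Function.injective_id) fun h => huv (hinj hu hv h)
      · rw [dvd_iff_isRoot]
        simp [ZMod.pow_card]
    have hdvd' : (∏ u ∈ D ×ˢ D, (X - C (u.2 - u.1 * m))) ∣ r.map (evalRingHom m) - X := by
      have := dvd_sub hdvd (Dvd.intro (q.map (evalRingHom m)) rfl)
      rw [hmap m] at this
      convert this using 1
      ring
    have hzero := eq_zero_of_dvd_of_degree_lt hdvd' (by
      rw [degree_eq_natDegree (Monic.ne_zero (monic_prod_of_monic _ _ fun u _ => monic_X_sub_C _)),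
        natDegree_prod_of_monic _ _ fun u _ => monic_X_sub_C _]
      simp only [natDegree_X_sub_C, Finset.sum_const, Finset.card_product, smul_eq_mul, mul_one]
      rw [← hk, ← sq]
      refine lt_of_le_of_lt (degree_sub_le _ _) (max_lt (lt_of_le_of_lt degree_map_le hrd) ?_)
      rw [degree_X]
      exact_mod_cast (by omega : 1 < k ^ 2))
    exact sub_eq_zero.1 hzero
  -- The coefficient of X^i has degree at most p - i in m but vanishes at the p - ρ non-slopes; here
  -- i ≥ 2 because ρ ≥ 1, so X itself contributes nothing.
  have hcoeff (i : ℕ) (hi : ρ < i) : r.coeff i = 0 := by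
    classical
    refine eq_zero_of_natDegree_lt_card_of_eval_eq_zero' _ (slopes D)ᶜ (fun m hm => ?_) ?_
    · have := congrArg (fun f => coeff f i) (hgen m (Finset.mem_compl.1 hm))
      simp only [coeff_map, coe_evalRingHom, coeff_X] at this
      rwa [if_neg (by omega)] at this
    · rw [Finset.card_compl, ZMod.card, ← hρ]
      refine lt_of_le_of_lt (natDegree_le_iff_coeff_eq_zero.2 fun j hj => hrW i j ?_)
        (by omega : p - i < p - ρ)
      omega
  -- Specialise at the slope 0, where the product degenerates: each y ∈ D is a root of multiplicity
  -- k. Since X^p has zero derivative, f^(k-1) divides g', whence k(k-1) < ρ unless g' = 0.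
  set g := r.map (evalRingHom (0 : ZMod p)) with hg
  have hgdeg : g.natDegree ≤ ρ := by
    refine natDegree_le_iff_coeff_eq_zero.2 fun i hi => ?_
    rw [hg, coeff_map, hcoeff i hi, map_zero]
  set f : (ZMod p)[X] := ∏ d ∈ D, (X - C d) with hf
  have hfm : f.Monic := monic_prod_of_monic _ _ fun u _ => monic_X_sub_C _
  have hfd : f.natDegree = k := by
    rw [hf, natDegree_prod_of_monic _ _ fun u _ => monic_X_sub_C _]
    simp [hk]
  have hfk : f ^ k ∣ X ^ p - g := by
    refine ⟨q.map (evalRingHom 0), ?_⟩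
    rw [hmap 0, add_sub_cancel_right, Finset.prod_product]
    simp [hf, hk]
  have hder : f ^ (k - 1) ∣ derivative g := by
    have := pow_sub_one_dvd_derivative_of_pow_dvd hfk
    simpa [derivative_X_pow] using this
  by_cases hg' : derivative g = 0
  · exfalso
    -- As deg g ≤ ρ < p, a zero derivative forces g to be constant; then d = d^p is the same for
    -- every d ∈ D.
    have hgc : g = C (g.coeff 0) := by
      ext i
      rw [coeff_C]
      split_ifs with hi
      · rw [hi]
      · by_cases hip : i < p
        · have := congrArg (fun f => coeff f (i - 1)) hg'
          simp only [coeff_derivative, coeff_zero, mul_eq_zero] at this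
          rw [Nat.sub_add_cancel (by omega)] at this
          refine this.resolve_right fun h => ?_
          have h2 : ((i : ℕ) : ZMod p) = 0 := by
            rw [← h, ← Nat.cast_succ, Nat.succ_eq_add_one, Nat.sub_add_cancel (by omega)]
          rw [ZMod.natCast_eq_zero_iff] at h2
          exact absurd (Nat.le_of_dvd (by omega) h2) (by omega)
        · exact coeff_eq_zero_of_natDegree_lt (by omega)
    have hroot (d : ZMod p) (hd : d ∈ D) : d = g.coeff 0 := by
      have h1 : (X - C d) ∣ X ^ p - g :=
        ((Finset.dvd_prod_of_mem _ hd).trans (dvd_pow_self f (by omega))).trans hfk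
      rw [dvd_iff_isRoot, hgc] at h1
      simpa [ZMod.pow_card, sub_eq_zero] using h1
    obtain ⟨a, ha, b, hb, hab⟩ := Finset.one_lt_card.1 hD
    exact hab ((hroot a ha).trans (hroot b hb).symm)
  · have h1 := natDegree_le_of_dvd hder hg'
    rw [hfm.natDegree_pow, hfd] at h1
    have h2 := natDegree_derivative_lt (p := g) fun h => hg' (derivative_of_natDegree_zero h)
    rw [mul_comm]
    omega

end Slopes

/-! ### Balog–Szemerédi–Gowers for many dilates at once -/

open Finset in
/-- If every `z ∈ S` has at least `ν` representations in `U`, then `#S * ν ≤ #U`. -/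
theorem card_mul_le_card_of_representations {γ δ ε : Type*} (S : Finset γ) (W : γ → Finset δ)
    (U : Finset ε) (ν : ℝ) (hν : ∀ z ∈ S, ν ≤ (W z).card) (f : γ → δ → ε)
    (hf : ∀ z ∈ S, ∀ w ∈ W z, f z w ∈ U)
    (hinj : ∀ z ∈ S, ∀ w ∈ W z, ∀ z' ∈ S, ∀ w' ∈ W z', f z w = f z' w' → z = z' ∧ w = w') :
    S.card * ν ≤ U.card := by
  have h1 : (S.sigma W).card ≤ U.card := by
    refine card_le_card_of_injOn (fun x => f x.1 x.2) ?_ ?_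
    · rintro ⟨z, w⟩ h
      rw [mem_coe, mem_sigma] at h
      exact hf z h.1 w h.2
    · rintro ⟨z, w⟩ h ⟨z', w'⟩ h' heq
      rw [mem_coe, mem_sigma] at h h'
      obtain ⟨rfl, rfl⟩ := hinj z h.1 w h.2 z' h'.1 w' h'.2 heq
      rfl
  rw [card_sigma] at h1
  calc (S.card : ℝ) * ν = ∑ z ∈ S, ν := by rw [sum_const, nsmul_eq_mul]
    _ ≤ ∑ z ∈ S, ((W z).card : ℝ) := sum_le_sum hν
    _ ≤ U.card := by exact_mod_cast h1

/-- The common neighbours of `b` and `b'` in the bipartite graph `G`. -/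
def commonNeighbors {α β : Type*} [DecidableEq α] [DecidableEq β] (G : Finset (α × β))
    (b b' : β) : Finset α :=
  (G.image Prod.fst).filter fun a => (a, b) ∈ G ∧ (a, b') ∈ G

theorem commonNeighbors_comm {α β : Type*} [DecidableEq α] [DecidableEq β] (G : Finset (α × β))
    (b b' : β) : commonNeighbors G b b' = commonNeighbors G b' b := by
  simp only [commonNeighbors, and_comm]

open Finset in
/-- Dependent random choice: in a dense bipartite graph some large neighbourhood has few pairs
with small codegree. -/
theorem exists_neighborhood_few_bad_pairs {α β : Type*} [DecidableEq α] [DecidableEq β]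
    (G : Finset (α × β)) (hG : G.Nonempty) (T θ : ℝ) (hT : 0 < T)
    (hA : ((G.image Prod.fst).card : ℝ) ≤ T) (hB : ((G.image Prod.snd).card : ℝ) ≤ T)
    (hθ0 : 0 ≤ θ) (hθ : θ * (200 * T ^ 3) = (G.card : ℝ) ^ 2) :
    ∃ B' : Finset β, (G.card : ℝ) ^ 2 ≤ 2 * T ^ 2 * (B'.card : ℝ) ^ 2 ∧
      100 * (((B' ×ˢ B').filter fun x => ((commonNeighbors G x.1 x.2).card : ℝ) < θ).card : ℝ)
        ≤ (B'.card : ℝ) ^ 2 := by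
  set A := G.image Prod.fst with hAdef
  set B := G.image Prod.snd with hBdef
  set nb : α → Finset β := fun a => B.filter fun b => (a, b) ∈ G with hnb
  set bad : Finset (β × β) :=
    (B ×ˢ B).filter fun x => ((commonNeighbors G x.1 x.2).card : ℝ) < θ with hbad
  have hGsum : (G.card : ℝ) = ∑ a ∈ A, ((nb a).card : ℝ) := by
    rw [card_eq_sum_card_image Prod.fst G, Nat.cast_sum]
    refine sum_congr rfl fun a _ => ?_
    congr 1
    refine card_nbij' (fun x => x.2) (fun b => (a, b)) ?_ ?_ ?_ ?_
    · rintro ⟨x, y⟩ h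
      simp only [coe_filter, Set.mem_ofPred_eq] at h
      obtain ⟨h, rfl⟩ := h
      simp only [hnb, hBdef, coe_filter, Set.mem_ofPred_eq]
      exact ⟨mem_image_of_mem Prod.snd h, h⟩
    · intro b h
      simp only [hnb, coe_filter, Set.mem_ofPred_eq] at h
      simpa using h.2
    · rintro ⟨x, y⟩ h
      simp only [coe_filter, Set.mem_ofPred_eq] at h
      obtain ⟨h, rfl⟩ := h
      rfl
    · intro b _; rfl
  have hCS : (G.card : ℝ) ^ 2 ≤ T * ∑ a ∈ A, ((nb a).card : ℝ) ^ 2 := by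
    rw [hGsum]
    exact sq_sum_le_card_mul_sum_sq.trans
      (mul_le_mul_of_nonneg_right hA (sum_nonneg fun _ _ => by positivity))
  have hbadsum : ∑ a ∈ A, ((bad.filter fun x => (a, x.1) ∈ G ∧ (a, x.2) ∈ G).card : ℝ)
      ≤ T ^ 2 * θ := by
    have h1 := sum_card_bipartiteAbove_eq_sum_card_bipartiteBelow (s := A) (t := bad)
      fun (a : α) (x : β × β) => (a, x.1) ∈ G ∧ (a, x.2) ∈ G
    simp only [bipartiteAbove, bipartiteBelow] at h1
    rw [← Nat.cast_sum, h1, Nat.cast_sum]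
    calc ∑ x ∈ bad, ((commonNeighbors G x.1 x.2).card : ℝ) ≤ ∑ x ∈ bad, θ :=
          sum_le_sum fun x hx => (mem_filter.1 hx).2.le
      _ = bad.card * θ := by rw [sum_const, nsmul_eq_mul]
      _ ≤ T ^ 2 * θ := by
          refine mul_le_mul_of_nonneg_right ?_ hθ0
          have h2 : (bad.card : ℝ) ≤ B.card * B.card := by
            exact_mod_cast (card_filter_le _ _).trans (card_product B B).le
          nlinarith [(Nat.cast_nonneg B.card : (0 : ℝ) ≤ B.card)]
  have hApos : (0 : ℝ) < A.card := by exact_mod_cast card_pos.2 (hG.image _)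
  have hGpos : (0 : ℝ) < G.card := by exact_mod_cast card_pos.2 hG
  -- Average over a. The choice of θ makes the penalty for bad pairs at most half of the second
  -- moment of the degrees; a positive difference then gives both conclusions for the same a.
  obtain ⟨a, -, ha⟩ : ∃ a ∈ A, (G.card : ℝ) ^ 2 / (2 * T ^ 2)
      ≤ ((nb a).card : ℝ) ^ 2
        - 100 * ((bad.filter fun x => (a, x.1) ∈ G ∧ (a, x.2) ∈ G).card : ℝ) := by
    refine exists_le_of_sum_le (card_pos.1 (by exact_mod_cast hApos)) ?_
    rw [sum_const, nsmul_eq_mul, sum_sub_distrib, ← mul_sum]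
    have h1 : (A.card : ℝ) * ((G.card : ℝ) ^ 2 / (2 * T ^ 2)) ≤ (G.card : ℝ) ^ 2 / (2 * T) := by
      calc (A.card : ℝ) * ((G.card : ℝ) ^ 2 / (2 * T ^ 2))
          ≤ T * ((G.card : ℝ) ^ 2 / (2 * T ^ 2)) :=
            mul_le_mul_of_nonneg_right hA (by positivity)
        _ = (G.card : ℝ) ^ 2 / (2 * T) := by field_simp
    have h2 : (G.card : ℝ) ^ 2 / T ≤ ∑ a ∈ A, ((nb a).card : ℝ) ^ 2 := by
      rw [div_le_iff₀ hT, mul_comm]; exact hCS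
    have h3 : 100 * (T ^ 2 * θ) = (G.card : ℝ) ^ 2 / T - (G.card : ℝ) ^ 2 / (2 * T) := by
      rw [← hθ]; field_simp; ring
    linarith
  have hbadnb : ((nb a ×ˢ nb a).filter fun x => ((commonNeighbors G x.1 x.2).card : ℝ) < θ)
      = bad.filter fun x => (a, x.1) ∈ G ∧ (a, x.2) ∈ G := by
    ext x
    simp only [hnb, hbad, mem_filter, mem_product]
    tauto
  refine ⟨nb a, ?_, ?_⟩
  · rw [div_le_iff₀ (by positivity)] at ha
    nlinarith [mul_nonneg (by positivity : 0 ≤ 2 * T ^ 2) (Nat.cast_nonneg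
      (bad.filter fun x => (a, x.1) ∈ G ∧ (a, x.2) ∈ G).card : (0 : ℝ) ≤ _)]
  · rw [hbadnb]
    have : 0 ≤ (G.card : ℝ) ^ 2 / (2 * T ^ 2) := by positivity
    linarith

open Finset in
/-- If few pairs of elements of `S` are bad, then most elements are pairwise joined by many paths
of three good pairs. -/
theorem exists_subset_many_good_paths {β : Type*} [DecidableEq β] (S : Finset β)
    (bad : β → β → Prop) [∀ x y, Decidable (bad x y)] (hsymm : ∀ x y, bad x y → bad y x)
    (hbad : 100 * ((S ×ˢ S).filter fun x => bad x.1 x.2).card ≤ S.card ^ 2) :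
    ∃ S' ⊆ S, 9 * S.card ≤ 10 * S'.card ∧ ∀ b ∈ S', ∀ b' ∈ S',
      S.card ^ 2 ≤ 2 * ((S ×ˢ S).filter fun x =>
        ¬ bad b x.1 ∧ ¬ bad x.2 x.1 ∧ ¬ bad x.2 b').card := by
  -- Markov's inequality: at most a tenth of S has more than a tenth of its pairs bad.
  set S' := S.filter fun b => 10 * (S.filter fun x => bad b x).card ≤ S.card with hS'
  refine ⟨S', filter_subset _ _, ?_, ?_⟩
  · have h1 : ((S ×ˢ S).filter fun x => bad x.1 x.2).card
        = ∑ b ∈ S, (S.filter fun x => bad b x).card := by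
      rw [card_filter, sum_product]
      exact sum_congr rfl fun b _ => (card_filter _ _).symm
    have h2 : (S.filter fun b => ¬ 10 * (S.filter fun x => bad b x).card ≤ S.card).card * S.card
        ≤ 10 * ∑ b ∈ S, (S.filter fun x => bad b x).card := by
      calc _ = ∑ b ∈ S.filter (fun b => ¬ 10 * (S.filter fun x => bad b x).card ≤ S.card),
              S.card := by rw [sum_const, smul_eq_mul]
        _ ≤ ∑ b ∈ S.filter (fun b => ¬ 10 * (S.filter fun x => bad b x).card ≤ S.card),
              10 * (S.filter fun x => bad b x).card :=
            sum_le_sum fun b hb => (not_le.1 (mem_filter.1 hb).2).le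
        _ ≤ ∑ b ∈ S, 10 * (S.filter fun x => bad b x).card :=
            sum_le_sum_of_subset (filter_subset _ _)
        _ = _ := by rw [mul_sum]
    have h3 : S'.card + (S.filter fun b =>
        ¬ 10 * (S.filter fun x => bad b x).card ≤ S.card).card = S.card :=
      card_filter_add_card_filter_not _
    rw [h1] at hbad
    rcases Nat.eq_zero_or_pos S.card with h0 | h0
    · omega
    · have h4 : 10 * (S.filter fun b =>
          ¬ 10 * (S.filter fun x => bad b x).card ≤ S.card).card ≤ S.card := by
        refine Nat.le_of_mul_le_mul_right ?_ h0
        nlinarith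
      omega
  · intro b hb b' hb'
    have hb := (mem_filter.1 hb).2
    have hb' := (mem_filter.1 hb').2
    -- The three ways to fail cost at most 1/10, 1/100 and 1/10 of all pairs, so more than half
    -- survive.
    have hcover : S ×ˢ S ⊆ ((S ×ˢ S).filter fun x =>
        ¬ bad b x.1 ∧ ¬ bad x.2 x.1 ∧ ¬ bad x.2 b') ∪
        ((S.filter fun x => bad b x) ×ˢ S) ∪ ((S ×ˢ S).filter fun x => bad x.1 x.2) ∪
        (S ×ˢ (S.filter fun x => bad b' x)) := by
      rintro ⟨x, y⟩ h
      simp only [mem_union, mem_filter, mem_product] at h ⊢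
      have h1 := hsymm y x
      have h2 := hsymm y b'
      tauto
    have hc := card_le_card hcover
    have hu1 := card_union_le (((S ×ˢ S).filter fun x =>
        ¬ bad b x.1 ∧ ¬ bad x.2 x.1 ∧ ¬ bad x.2 b') ∪
        ((S.filter fun x => bad b x) ×ˢ S) ∪ ((S ×ˢ S).filter fun x => bad x.1 x.2))
        (S ×ˢ (S.filter fun x => bad b' x))
    have hu2 := card_union_le (((S ×ˢ S).filter fun x =>
        ¬ bad b x.1 ∧ ¬ bad x.2 x.1 ∧ ¬ bad x.2 b') ∪
        ((S.filter fun x => bad b x) ×ˢ S)) ((S ×ˢ S).filter fun x => bad x.1 x.2)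
    have hu3 := card_union_le ((S ×ˢ S).filter fun x =>
        ¬ bad b x.1 ∧ ¬ bad x.2 x.1 ∧ ¬ bad x.2 b') ((S.filter fun x => bad b x) ×ˢ S)
    rw [card_product] at hc hu1 hu3
    have e1 := Nat.mul_le_mul_right S.card hb
    have e2 := Nat.mul_le_mul_right S.card hb'
    nlinarith

open Finset in
/-- A dense graph `G` with few sums `a + c * b` for all `c ∈ Λ` contains a large set `B` such that
all differences of two dilates of `B` by elements of `Λ` are small. -/
theorem exists_set_small_dilate_differences {F : Type*} [Field F] [DecidableEq F]
    (G : Finset (F × F)) (hG : G.Nonempty) (Λ : Finset F) (hΛ : (0 : F) ∉ Λ) (T : ℝ) (hT : 0 < T)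
    (hA : ((G.image Prod.fst).card : ℝ) ≤ T) (hB : ((G.image Prod.snd).card : ℝ) ≤ T)
    (hsum : ∀ c ∈ Λ, ((G.image fun x => x.1 + c * x.2).card : ℝ) ≤ T) :
    ∃ B : Finset F, (G.card : ℝ) ≤ 2 * T * B.card ∧ ∀ c ∈ Λ, ∀ c' ∈ Λ,
      (((B ×ˢ B).image fun x => c * x.1 - c' * x.2).card : ℝ) * (G.card : ℝ) ^ 8
        ≤ 32000000 * T ^ 17 := by
  classical
  have hGpos : (0 : ℝ) < G.card := by exact_mod_cast card_pos.2 hG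
  set θ : ℝ := (G.card : ℝ) ^ 2 / (200 * T ^ 3) with hθ
  have hθpos : 0 < θ := by positivity
  have hθT : θ * (200 * T ^ 3) = (G.card : ℝ) ^ 2 := by rw [hθ]; field_simp
  obtain ⟨S, hS, hSbad⟩ :=
    exists_neighborhood_few_bad_pairs G hG T θ hT hA hB hθpos.le hθT
  obtain ⟨B, hBS, hBcard, hpaths⟩ := exists_subset_many_good_paths S
    (fun b b' => ((commonNeighbors G b b').card : ℝ) < θ)
    (fun x y h => by rwa [commonNeighbors_comm]) (by exact_mod_cast hSbad)
  have hBcard' : 9 * (S.card : ℝ) ≤ 10 * B.card := by exact_mod_cast hBcard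
  refine ⟨B, ?_, fun c hc c' hc' => ?_⟩
  · refine le_of_sq_le_sq ?_ (by positivity)
    have : (S.card : ℝ) ^ 2 ≤ 2 * (B.card : ℝ) ^ 2 := by
      nlinarith [(Nat.cast_nonneg S.card : (0 : ℝ) ≤ S.card)]
    nlinarith [mul_le_mul_of_nonneg_left this (by positivity : 0 ≤ 2 * T ^ 2)]
  · have hc0 : c ≠ 0 := fun h => hΛ (h ▸ hc)
    have hc0' : c' ≠ 0 := fun h => hΛ (h ▸ hc')
    set Δ : Finset F := ((S ×ˢ S).filter fun x =>
      ¬ ((commonNeighbors G x.1 x.2).card : ℝ) < θ).image fun x => c * x.1 - c' * x.2 with hΔ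
    -- Each common neighbour a writes c b - c' b' as (a + c b) - (a + c' b'), giving at least θ
    -- representations as a difference of elements of two sets of size at most T.
    have hΔcard : (Δ.card : ℝ) * θ ≤ T ^ 2 := by
      have hex : ∀ z, ∃ x : F × F, z ∈ Δ →
          θ ≤ ((commonNeighbors G x.1 x.2).card : ℝ) ∧ c * x.1 - c' * x.2 = z := by
        intro z
        by_cases hz : z ∈ Δ
        · obtain ⟨x, hx, rfl⟩ := mem_image.1 hz
          exact ⟨x, fun _ => ⟨not_lt.1 (mem_filter.1 hx).2, rfl⟩⟩
        · exact ⟨0, fun h => (hz h).elim⟩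
      choose x hx using hex
      refine (card_mul_le_card_of_representations Δ (fun z => commonNeighbors G (x z).1 (x z).2)
        ((G.image fun x => x.1 + c * x.2) ×ˢ (G.image fun x => x.1 + c' * x.2)) θ
        (fun z hz => (hx z hz).1) (fun z a => (a + c * (x z).1, a + c' * (x z).2)) ?_ ?_).trans ?_
      · intro z hz a ha
        have ha := (mem_filter.1 ha).2
        exact mem_product.2 ⟨mem_image.2 ⟨_, ha.1, rfl⟩, mem_image.2 ⟨_, ha.2, rfl⟩⟩
      · intro z hz a ha z' hz' a' ha' h
        rw [Prod.mk.injEq] at h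
        have hzz : z = z' := by
          rw [← (hx z hz).2, ← (hx z' hz').2]
          linear_combination h.1 - h.2
        subst hzz
        exact ⟨rfl, add_right_cancel h.1⟩
      · rw [card_product, Nat.cast_mul, sq]
        exact mul_le_mul (hsum c hc) (hsum c' hc') (by positivity) hT.le
    -- Along a path b, y₁, y₂, b' of good pairs, c b - c' b' = (c b - c' y₁) - (c y₂ - c' y₁) + (c
    -- y₂ - c' b'), with all three terms in `Δ`.
    have hdiff : (((B ×ˢ B).image fun x => c * x.1 - c' * x.2).card : ℝ) *
        ((S.card : ℝ) ^ 2 / 2) ≤ (Δ.card : ℝ) ^ 3 := by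
      have hex : ∀ z, ∃ x : F × F, z ∈ ((B ×ˢ B).image fun x => c * x.1 - c' * x.2) →
          x.1 ∈ B ∧ x.2 ∈ B ∧ c * x.1 - c' * x.2 = z := by
        intro z
        by_cases hz : z ∈ ((B ×ˢ B).image fun x => c * x.1 - c' * x.2)
        · obtain ⟨x, hx, rfl⟩ := mem_image.1 hz
          exact ⟨x, fun _ => ⟨(mem_product.1 hx).1, (mem_product.1 hx).2, rfl⟩⟩
        · exact ⟨0, fun h => (hz h).elim⟩
      choose x hx using hex
      refine (card_mul_le_card_of_representations _ (fun z => (S ×ˢ S).filter fun y =>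
        ¬ ((commonNeighbors G (x z).1 y.1).card : ℝ) < θ ∧
        ¬ ((commonNeighbors G y.2 y.1).card : ℝ) < θ ∧
        ¬ ((commonNeighbors G y.2 (x z).2).card : ℝ) < θ) (Δ ×ˢ Δ ×ˢ Δ) ((S.card : ℝ) ^ 2 / 2)
        ?_ (fun z y => (c * (x z).1 - c' * y.1, c * y.2 - c' * y.1, c * y.2 - c' * (x z).2))
        ?_ ?_).trans ?_
      · intro z hz
        obtain ⟨h1, h2, -⟩ := hx z hz
        rw [div_le_iff₀ (by norm_num), mul_comm]
        exact_mod_cast hpaths _ h1 _ h2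
      · intro z hz y hy
        obtain ⟨h1, h2, -⟩ := hx z hz
        obtain ⟨hy0, hy1, hy2, hy3⟩ := mem_filter.1 hy
        obtain ⟨hy4, hy5⟩ := mem_product.1 hy0
        refine mem_product.2 ⟨mem_image.2 ⟨((x z).1, y.1), mem_filter.2 ⟨?_, hy1⟩, rfl⟩,
          mem_product.2 ⟨mem_image.2 ⟨(y.2, y.1), mem_filter.2 ⟨?_, hy2⟩, rfl⟩,
            mem_image.2 ⟨(y.2, (x z).2), mem_filter.2 ⟨?_, hy3⟩, rfl⟩⟩⟩
        · exact mem_product.2 ⟨hBS h1, hy4⟩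
        · exact mem_product.2 ⟨hy5, hy4⟩
        · exact mem_product.2 ⟨hy5, hBS h2⟩
      · intro z hz y hy z' hz' y' hy' h
        simp only [Prod.mk.injEq] at h
        obtain ⟨e1, e2, e3⟩ := h
        have hzz : z = z' := by
          rw [← (hx z hz).2.2, ← (hx z' hz').2.2]
          linear_combination e1 - e2 + e3
        subst hzz
        have e4 : y.1 = y'.1 := mul_left_cancel₀ hc0' (by linear_combination -e1)
        have e5 : y.2 = y'.2 := mul_left_cancel₀ hc0 (by linear_combination e3)
        exact ⟨rfl, Prod.ext e4 e5⟩
      · rw [card_product, card_product]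
        push_cast
        exact (by ring : (Δ.card : ℝ) * (Δ.card * Δ.card) = Δ.card ^ 3).le
    set X : ℝ := (((B ×ˢ B).image fun x => c * x.1 - c' * x.2).card : ℝ) with hX
    have hX0 : 0 ≤ X := Nat.cast_nonneg _
    have h1 : (Δ.card : ℝ) * (G.card : ℝ) ^ 2 ≤ 200 * T ^ 5 := by
      rw [← hθT]
      calc (Δ.card : ℝ) * (θ * (200 * T ^ 3)) = Δ.card * θ * (200 * T ^ 3) := by ring
        _ ≤ T ^ 2 * (200 * T ^ 3) := mul_le_mul_of_nonneg_right hΔcard (by positivity)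
        _ = 200 * T ^ 5 := by ring
    have h2 : X * (G.card : ℝ) ^ 2 ≤ 4 * T ^ 2 * (Δ.card : ℝ) ^ 3 := by
      calc X * (G.card : ℝ) ^ 2 ≤ X * (2 * T ^ 2 * (S.card : ℝ) ^ 2) :=
            mul_le_mul_of_nonneg_left hS hX0
        _ = 4 * T ^ 2 * (X * ((S.card : ℝ) ^ 2 / 2)) := by ring
        _ ≤ 4 * T ^ 2 * (Δ.card : ℝ) ^ 3 := mul_le_mul_of_nonneg_left hdiff (by positivity)
    calc X * (G.card : ℝ) ^ 8 = X * (G.card : ℝ) ^ 2 * (G.card : ℝ) ^ 6 := by ring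
      _ ≤ 4 * T ^ 2 * (Δ.card : ℝ) ^ 3 * (G.card : ℝ) ^ 6 :=
          mul_le_mul_of_nonneg_right h2 (by positivity)
      _ = 4 * T ^ 2 * ((Δ.card : ℝ) * (G.card : ℝ) ^ 2) ^ 3 := by ring
      _ ≤ 4 * T ^ 2 * (200 * T ^ 5) ^ 3 := by gcongr
      _ = 32000000 * T ^ 17 := by ring

/-! ### Growth of B + mB: collisions against Plünnecke -/

-- Cauchy–Schwarz over the fibres of `f`.
open Finset in
theorem card_sq_le_card_image_mul_card_collisions {σ τ : Type*} [DecidableEq τ] (S : Finset σ)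
    (f : σ → τ) :
    S.card ^ 2 ≤ (S.image f).card * ((S ×ˢ S).filter fun x => f x.1 = f x.2).card := by
  have h1 : ((S ×ˢ S).filter fun x => f x.1 = f x.2).card
      = ∑ c ∈ S.image f, (S.filter fun x => f x = c).card ^ 2 := by
    rw [card_eq_sum_card_fiberwise (f := fun x => f x.1) (t := S.image f)]
    · refine sum_congr rfl fun c _ => ?_
      rw [sq, ← card_product]
      congr 1
      ext x
      simp only [mem_filter, mem_product]
      constructor
      · rintro ⟨⟨⟨h1, h2⟩, h3⟩, h4⟩
        exact ⟨⟨h1, h4⟩, h2, h3 ▸ h4⟩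
      · rintro ⟨⟨h1, h2⟩, h3, h4⟩
        exact ⟨⟨⟨h1, h3⟩, h2.trans h4.symm⟩, h2⟩
    · intro x hx
      exact mem_image_of_mem f (mem_product.1 (mem_filter.1 hx).1).1
  rw [h1, card_eq_sum_card_image f S]
  exact sq_sum_le_card_mul_sum_sq

open Finset in
/-- If any two distinct points of `S` collide under at most one of the maps `f c`, then some `f c`
with `c ∈ R` has a large image. -/
theorem exists_large_image {ρ σ τ : Type*} [DecidableEq τ] (R : Finset ρ) (hR : R.Nonempty)
    (S : Finset σ) (f : ρ → σ → τ)
    (hf : ∀ x y, x ≠ y → ∀ c c', f c x = f c y → f c' x = f c' y → c = c') :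
    ∃ c ∈ R, S.card * R.card ≤ (S.image (f c)).card * (R.card + S.card) := by
  classical
  -- Take the map with fewest collisions. Over all of `R`, diagonal pairs contribute |S||R| and each
  -- off-diagonal pair at most one, so the minimum is at most the average of these.
  obtain ⟨c, hc, hcmin⟩ := exists_min_image R
    (fun c => ((S ×ˢ S).filter fun x => f c x.1 = f c x.2).card) hR
  refine ⟨c, hc, ?_⟩
  set E := ((S ×ˢ S).filter fun x => f c x.1 = f c x.2).card with hE
  have hsum : R.card * E ≤ S.card * (R.card + S.card) := by
    calc R.card * E = ∑ c ∈ R, E := by rw [sum_const, smul_eq_mul]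
      _ ≤ ∑ c ∈ R, ((S ×ˢ S).filter fun x => f c x.1 = f c x.2).card := sum_le_sum hcmin
      _ = ∑ x ∈ S ×ˢ S, (R.filter fun c => f c x.1 = f c x.2).card :=
          sum_card_bipartiteAbove_eq_sum_card_bipartiteBelow fun c (x : σ × σ) => f c x.1 = f c x.2
      _ ≤ ∑ x ∈ S ×ˢ S, ((if x.1 = x.2 then R.card else 0) + 1) := by
          refine sum_le_sum fun x _ => ?_
          split_ifs with h
          · exact (card_filter_le _ _).trans (Nat.le_succ _)
          · rw [zero_add, card_le_one]
            intro a ha b hb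
            exact hf _ _ h a b (mem_filter.1 ha).2 (mem_filter.1 hb).2
      _ = S.card * (R.card + S.card) := by
          rw [sum_add_distrib, sum_product]
          simp [mul_add]
  have hmain := card_sq_le_card_image_mul_card_collisions S (f c)
  rw [← hE] at hmain
  rcases Nat.eq_zero_or_pos S.card with h0 | h0
  · simp [h0]
  · refine Nat.le_of_mul_le_mul_left ?_ h0
    calc S.card * (S.card * R.card) = S.card ^ 2 * R.card := by ring
      _ ≤ (S.image (f c)).card * E * R.card := Nat.mul_le_mul_right _ hmain
      _ = (S.image (f c)).card * (R.card * E) := by ring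
      _ ≤ (S.image (f c)).card * (S.card * (R.card + S.card)) := Nat.mul_le_mul_left _ hsum
      _ = _ := by ring

open Finset Pointwise in
/-- If the differences of dilates of `B` by elements of `Λ` are small, then so is `B + m B` for
every slope `m` of `Λ`. -/
theorem card_add_dilate_le {F : Type*} [Field F] [DecidableEq F] (B Λ : Finset F)
    (hB : B.Nonempty) (hΛ : (0 : F) ∉ Λ) (W : ℝ)
    (hW : ∀ c ∈ Λ, ∀ c' ∈ Λ, (((B ×ˢ B).image fun x => c * x.1 - c' * x.2).card : ℝ) ≤ W)
    {m : F} (hm : m ∈ slopes Λ) :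
    (((B ×ˢ B).image fun x => x.1 + m * x.2).card : ℝ) * (B.card : ℝ) ^ 3 ≤ 256 * W ^ 4 := by
  obtain ⟨x₁, hx₁, x₂, hx₂, y₁, hy₁, y₂, hy₂, hx, rfl⟩ := mem_slopes.1 hm
  have hBpos : (0 : ℝ) < B.card := by exact_mod_cast card_pos.2 hB
  have hsub : x₁ - x₂ ≠ 0 := sub_ne_zero.2 hx
  have hx₁0 : x₁ ≠ 0 := fun h => hΛ (h ▸ hx₁)
  have hW0 : 0 ≤ W := (Nat.cast_nonneg _).trans (hW x₁ hx₁ x₁ hx₁)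
  set Λ' : Finset F := {x₁, x₂, y₁, y₂} with hΛ'
  have hΛ'Λ : Λ' ⊆ Λ := by
    intro c hc
    simp only [hΛ', mem_insert, mem_singleton] at hc
    rcases hc with rfl | rfl | rfl | rfl <;> assumption
  set X : Finset F := B.image fun b => x₁ * b with hX
  -- Multiplying by x₁ - x₂ places B + mB inside 2H - 2H. Only the four dilates defining m are
  -- needed, so |X - H| ≤ 4W with no dependence on |Λ|.
  set H : Finset F := Λ'.biUnion fun c => B.image fun b => c * b with hH
  have hmemH (c : F) (hc : c ∈ Λ') (b : F) (hb : b ∈ B) : c * b ∈ H :=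
    mem_biUnion.2 ⟨c, hc, mem_image_of_mem _ hb⟩
  have hXcard : X.card = B.card := card_image_of_injective _ (mul_right_injective₀ hx₁0)
  have hXH : ((X - H).card : ℝ) ≤ 4 * W := by
    have h1 : X - H ⊆ Λ'.biUnion fun c => (B ×ˢ B).image fun x => x₁ * x.1 - c * x.2 := by
      intro z hz
      obtain ⟨u, hu, v, hv, rfl⟩ := mem_sub.1 hz
      obtain ⟨b, hb, rfl⟩ := mem_image.1 hu
      obtain ⟨c, hc, hv⟩ := mem_biUnion.1 hv
      obtain ⟨b', hb', rfl⟩ := mem_image.1 hv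
      exact mem_biUnion.2 ⟨c, hc, mem_image.2 ⟨(b, b'), mem_product.2 ⟨hb, hb'⟩, rfl⟩⟩
    calc ((X - H).card : ℝ)
        ≤ ∑ c ∈ Λ', (((B ×ˢ B).image fun x => x₁ * x.1 - c * x.2).card : ℝ) := by
          exact_mod_cast (card_le_card h1).trans card_biUnion_le
      _ ≤ ∑ c ∈ Λ', W := sum_le_sum fun c hc => hW _ hx₁ _ (hΛ'Λ hc)
      _ = Λ'.card * W := by rw [sum_const, nsmul_eq_mul]
      _ ≤ 4 * W := mul_le_mul_of_nonneg_right (by exact_mod_cast card_le_four) hW0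
  have hpl := pluennecke_ruzsa_inequality_nsmul_sub_nsmul_sub (hB.image fun b => x₁ * b) H 2 2
  rw [← hX] at hpl
  have hpl' : ((2 • H - 2 • H).card : ℝ) ≤ (((X - H).card : ℝ) / X.card) ^ 4 * X.card := by
    have := (NNRat.cast_le (K := ℝ)).2 hpl
    push_cast at this
    exact this
  have him : (((B ×ˢ B).image fun x => x.1 + (y₁ - y₂) / (x₁ - x₂) * x.2).card : ℝ)
      ≤ ((2 • H - 2 • H).card : ℝ) := by
    rw [Nat.cast_le]
    refine card_le_card_of_injOn (fun z => (x₁ - x₂) * z) ?_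
      (mul_right_injective₀ hsub).injOn
    intro z hz
    obtain ⟨⟨b, b'⟩, hb, rfl⟩ := mem_image.1 hz
    obtain ⟨hb, hb'⟩ := mem_product.1 hb
    have heq : (x₁ - x₂) * (b + (y₁ - y₂) / (x₁ - x₂) * b')
        = (x₁ * b + y₁ * b') - (x₂ * b + y₂ * b') := by
      field_simp; ring
    dsimp only
    rw [heq, mem_coe, two_nsmul]
    exact sub_mem_sub
      (add_mem_add (hmemH _ (by simp [hΛ']) _ hb) (hmemH _ (by simp [hΛ']) _ hb'))
      (add_mem_add (hmemH _ (by simp [hΛ']) _ hb) (hmemH _ (by simp [hΛ']) _ hb'))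
  rw [hXcard] at hpl'
  calc _ ≤ (((X - H).card : ℝ) / B.card) ^ 4 * B.card * (B.card : ℝ) ^ 3 :=
        mul_le_mul_of_nonneg_right (him.trans hpl') (by positivity)
    _ = ((X - H).card : ℝ) ^ 4 := by field_simp
    _ ≤ (4 * W) ^ 4 := by gcongr
    _ = 256 * W ^ 4 := by ring

open Finset in
/-- A graph `G` with few sums `a + c * b` for all `c` in a set `Λ` cannot be too dense. -/
theorem card_pow_le_of_few_sums {p : ℕ} [Fact p.Prime] (G : Finset (ZMod p × ZMod p))
    (hG : G.Nonempty) (Λ : Finset (ZMod p)) (hΛ : (0 : ZMod p) ∉ Λ) (hΛ2 : 2 ≤ Λ.card)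
    (hΛp : Λ.card ^ 2 ≤ p) (T : ℝ) (hT : 0 < T)
    (hA : ((G.image Prod.fst).card : ℝ) ≤ T) (hB : ((G.image Prod.snd).card : ℝ) ≤ T)
    (hsum : ∀ c ∈ Λ, ((G.image fun x => x.1 + c * x.2).card : ℝ) ≤ T) :
    (G.card : ℝ) ^ 37 ≤ 2 ^ 14 * 32000000 ^ 4 * T ^ 73 ∨
      (Λ.card : ℝ) ^ 2 * (G.card : ℝ) ^ 35 ≤ 2 ^ 14 * 32000000 ^ 4 * T ^ 71 := by
  obtain ⟨B, hGB, hdiff⟩ := exists_set_small_dilate_differences G hG Λ hΛ T hT hA hB hsum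
  have hg : (0 : ℝ) < G.card := by exact_mod_cast card_pos.2 hG
  have hb : (0 : ℝ) < B.card := by
    by_contra h
    have : (B.card : ℝ) = 0 := le_antisymm (not_lt.1 h) (Nat.cast_nonneg _)
    rw [this, mul_zero] at hGB
    linarith
  have hBne : B.Nonempty := card_pos.1 (by exact_mod_cast hb)
  set W : ℝ := 32000000 * T ^ 17 / (G.card : ℝ) ^ 8 with hWdef
  have hWG : W * (G.card : ℝ) ^ 8 = 32000000 * T ^ 17 := by rw [hWdef]; field_simp
  have hW0 : 0 < W := by positivity
  have hslopes := card_mul_lt_card_slopes Λ hΛ2 hΛp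
  have hRpos : 0 < (slopes Λ).card := by omega
  obtain ⟨m, hm, hlarge⟩ := exists_large_image (slopes Λ) (card_pos.1 hRpos) (B ×ˢ B)
    (fun m x => x.1 + m * x.2) (by
      rintro ⟨a, b⟩ ⟨a', b'⟩ hne c c' h h'
      dsimp only at h h'
      by_contra hcc
      have hbb : b = b' := by
        have : (c - c') * (b - b') = 0 := by linear_combination h - h'
        exact sub_eq_zero.1 ((mul_eq_zero.1 this).resolve_left (sub_ne_zero.2 hcc))
      subst hbb
      exact hne (by rw [add_right_cancel h]))
  have hsmall := card_add_dilate_le B Λ hBne hΛ W (fun c hc c' hc' => by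
    rw [hWdef, le_div_iff₀ (by positivity)]
    exact hdiff c hc c' hc') hm
  rw [card_product] at hlarge
  set I := ((B ×ˢ B).image fun x => x.1 + m * x.2).card
  set R : ℝ := ((slopes Λ).card : ℝ) with hR
  have hR0 : 0 < R := by rw [hR]; exact_mod_cast hRpos
  have hlarge' : (B.card : ℝ) ^ 2 * R ≤ I * (R + (B.card : ℝ) ^ 2) := by
    rw [sq, hR]; exact_mod_cast hlarge
  have hkR : (Λ.card : ℝ) ^ 2 ≤ 2 * R := by
    have : Λ.card ^ 2 ≤ 2 * (slopes Λ).card := by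
      obtain ⟨k, hk⟩ : ∃ k, Λ.card = k + 2 := ⟨Λ.card - 2, by omega⟩
      rw [hk] at hslopes ⊢
      simp only [Nat.add_succ_sub_one] at hslopes
      nlinarith
    rw [hR]; exact_mod_cast this
  set b : ℝ := (B.card : ℝ) with hbdef
  set g : ℝ := (G.card : ℝ) with hgdef
  have hkey : b ^ 5 * R ≤ 256 * W ^ 4 * (R + b ^ 2) := by
    calc b ^ 5 * R = b ^ 3 * (b ^ 2 * R) := by ring
      _ ≤ b ^ 3 * (I * (R + b ^ 2)) := mul_le_mul_of_nonneg_left hlarge' (by positivity)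
      _ = I * b ^ 3 * (R + b ^ 2) := by ring
      _ ≤ _ := mul_le_mul_of_nonneg_right hsmall (by positivity)
  have hW4 : W ^ 4 * g ^ 32 = 32000000 ^ 4 * T ^ 68 := by
    calc W ^ 4 * g ^ 32 = (W * g ^ 8) ^ 4 := by ring
      _ = _ := by rw [hWG]; ring
  -- The collision bound makes the image at least half of min(b², R); the two cases give the two
  -- alternatives.
  rcases le_total (b ^ 2) R with h | h
  · left
    have h1 : b ^ 5 ≤ 512 * W ^ 4 := by
      refine le_of_mul_le_mul_right ?_ hR0
      calc b ^ 5 * R ≤ 256 * W ^ 4 * (R + b ^ 2) := hkey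
        _ ≤ 256 * W ^ 4 * (R + R) := by gcongr
        _ = _ := by ring
    calc g ^ 37 = g ^ 5 * g ^ 32 := by ring
      _ ≤ (2 * T * b) ^ 5 * g ^ 32 := by gcongr
      _ = 32 * T ^ 5 * g ^ 32 * b ^ 5 := by ring
      _ ≤ 32 * T ^ 5 * g ^ 32 * (512 * W ^ 4) := by gcongr
      _ = 2 ^ 14 * T ^ 5 * (W ^ 4 * g ^ 32) := by ring
      _ = _ := by rw [hW4]; ring
  · right
    have h1 : b ^ 3 * R ≤ 512 * W ^ 4 := by
      refine le_of_mul_le_mul_right ?_ (by positivity : 0 < b ^ 2)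
      calc b ^ 3 * R * b ^ 2 = b ^ 5 * R := by ring
        _ ≤ 256 * W ^ 4 * (R + b ^ 2) := hkey
        _ ≤ 256 * W ^ 4 * (b ^ 2 + b ^ 2) := by gcongr
        _ = _ := by ring
    calc (Λ.card : ℝ) ^ 2 * g ^ 35 ≤ 2 * R * g ^ 35 := by gcongr
      _ = 2 * R * g ^ 32 * g ^ 3 := by ring
      _ ≤ 2 * R * g ^ 32 * (2 * T * b) ^ 3 := by gcongr
      _ = 16 * T ^ 3 * g ^ 32 * (b ^ 3 * R) := by ring
      _ ≤ 16 * T ^ 3 * g ^ 32 * (512 * W ^ 4) := by gcongr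
      _ = 2 ^ 13 * T ^ 3 * (W ^ 4 * g ^ 32) := by ring
      _ = 2 ^ 13 * (32000000 ^ 4 * T ^ 71) := by rw [hW4]; ring
      _ ≤ 2 ^ 14 * 32000000 ^ 4 * T ^ 71 := by
          have : 0 ≤ 32000000 ^ 4 * T ^ 71 := by positivity
          linarith

/-! ### Incidences and a rich line of low-degree points -/

section Incidence

variable {F : Type*} [Field F]

theorem mem_linesDetermined {P : Finset (F × F)} {l : AffineSubspace F (F × F)} :
    l ∈ linesDetermined P ↔ ∃ x ∈ P, ∃ y ∈ P, x ≠ y ∧ affineSpan F {x, y} = l := by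
  simp only [linesDetermined, Finset.mem_image, Finset.mem_offDiag, Prod.exists]
  constructor
  · rintro ⟨x₁, x₂, y₁, y₂, ⟨hx, hy, hxy⟩, h⟩
    exact ⟨_, _, hx, _, _, hy, hxy, h⟩
  · rintro ⟨x₁, x₂, hx, y₁, y₂, hy, hxy, h⟩
    exact ⟨_, _, _, _, ⟨hx, hy, hxy⟩, h⟩

theorem mem_pointsOn {P : Finset (F × F)} {l : AffineSubspace F (F × F)} {x : F × F} :
    x ∈ pointsOn P l ↔ x ∈ P ∧ x ∈ l := by
  simp [pointsOn]

theorem isPlaneLine_affineSpan_pair {x y : F × F} (h : x ≠ y) :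
    IsPlaneLine (affineSpan F {x, y}) := by
  rw [IsPlaneLine, direction_affineSpan, vectorSpan_pair_rev]
  exact finrank_span_singleton (vsub_ne_zero.2 h.symm)

theorem isPlaneLine_of_mem_linesDetermined {P : Finset (F × F)} {l : AffineSubspace F (F × F)}
    (hl : l ∈ linesDetermined P) : IsPlaneLine l := by
  obtain ⟨x, -, y, -, hxy, rfl⟩ := mem_linesDetermined.1 hl
  exact isPlaneLine_affineSpan_pair hxy

theorem affineSpan_pair_eq_of_mem_of_mem {a b x y : F × F} (hab : a ≠ b) (hxy : x ≠ y)
    (hx : x ∈ affineSpan F {a, b}) (hy : y ∈ affineSpan F {a, b}) :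
    affineSpan F {x, y} = affineSpan F {a, b} := by
  have h := collinear_insert_insert_of_mem_affineSpan_pair hx hy
  rw [h.affineSpan_eq_of_ne (by simp) (by simp) hxy, h.affineSpan_eq_of_ne (by simp) (by simp) hab]

open Classical in
/-- The number of lines determined by `P` that pass through `x`. -/
noncomputable def lineDegree (P : Finset (F × F)) (x : F × F) : ℕ :=
  ((linesDetermined P).filter fun l => x ∈ l).card

-- Double counting: two distinct points of `S` lie on exactly one line determined by `P`.
open Classical Finset in
theorem sum_card_offDiag_pointsOn {P S : Finset (F × F)} (hS : S ⊆ P) :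
    ∑ l ∈ linesDetermined P, (pointsOn S l).offDiag.card = S.offDiag.card := by
  have h := sum_card_bipartiteAbove_eq_sum_card_bipartiteBelow (s := linesDetermined P)
    (t := S.offDiag) fun l (x : (F × F) × (F × F)) => x.1 ∈ l ∧ x.2 ∈ l
  have h1 : ∀ l ∈ linesDetermined P, (pointsOn S l).offDiag.card
      = (bipartiteAbove (fun l (x : (F × F) × (F × F)) => x.1 ∈ l ∧ x.2 ∈ l) S.offDiag l).card := by
    intro l _
    congr 1
    ext x
    simp only [bipartiteAbove, mem_offDiag, mem_filter, mem_pointsOn]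
    tauto
  rw [sum_congr rfl h1, h, card_eq_sum_ones]
  refine sum_congr rfl fun x hx => ?_
  obtain ⟨hx1, hx2, hne⟩ := mem_offDiag.1 hx
  rw [card_eq_one]
  refine ⟨affineSpan F {x.1, x.2}, ?_⟩
  ext l
  simp only [bipartiteBelow, mem_filter, mem_singleton]
  constructor
  · rintro ⟨hl, h1, h2⟩
    obtain ⟨a, -, b, -, hab, rfl⟩ := mem_linesDetermined.1 hl
    exact (affineSpan_pair_eq_of_mem_of_mem hab hne h1 h2).symm
  · rintro rfl
    exact ⟨mem_linesDetermined.2 ⟨_, hS hx1, _, hS hx2, hne, rfl⟩,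
      left_mem_affineSpan_pair _ _ _, right_mem_affineSpan_pair _ _ _⟩

open Finset in
theorem two_le_card_pointsOn {P : Finset (F × F)} {l : AffineSubspace F (F × F)}
    (hl : l ∈ linesDetermined P) : 2 ≤ (pointsOn P l).card := by
  obtain ⟨x, hx, y, hy, hxy, rfl⟩ := mem_linesDetermined.1 hl
  exact one_lt_card.2 ⟨x, mem_pointsOn.2 ⟨hx, left_mem_affineSpan_pair _ _ _⟩, y,
    mem_pointsOn.2 ⟨hy, right_mem_affineSpan_pair _ _ _⟩, hxy⟩

open Finset in
/-- Cauchy–Schwarz bound for the incidences between `P` and the lines determined by `P`. -/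
theorem sq_sum_lineDegree_le (P : Finset (F × F)) :
    (∑ x ∈ P, lineDegree P x) ^ 2 ≤ 2 * (linesDetermined P).card * P.card ^ 2 := by
  classical
  have h1 : ∑ x ∈ P, lineDegree P x = ∑ l ∈ linesDetermined P, (pointsOn P l).card := by
    have := sum_card_bipartiteAbove_eq_sum_card_bipartiteBelow (s := P) (t := linesDetermined P)
      fun x l => x ∈ l
    convert this using 2
    · rw [lineDegree, bipartiteAbove]
    · rw [pointsOn, bipartiteBelow]
  have h2 : ∑ l ∈ linesDetermined P, (pointsOn P l).card ^ 2 ≤ 2 * P.card ^ 2 := by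
    have h3 : ∀ l ∈ linesDetermined P,
        (pointsOn P l).card ^ 2 ≤ 2 * (pointsOn P l).offDiag.card := by
      intro l hl
      have h4 := two_le_card_pointsOn hl
      rw [offDiag_card]
      obtain ⟨k, hk⟩ : ∃ k, (pointsOn P l).card = k + 2 := ⟨(pointsOn P l).card - 2, by omega⟩
      rw [hk]
      have : (k + 2) * (k + 2) - (k + 2) = (k + 2) * (k + 1) := by
        rw [← Nat.mul_sub_one]; rfl
      rw [this]; nlinarith
    refine (sum_le_sum h3).trans ?_
    rw [← mul_sum]
    refine Nat.mul_le_mul_left _ ?_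
    have := sum_card_offDiag_pointsOn (Subset.refl P)
    rw [offDiag_card] at this
    simp only [offDiag_card] at this ⊢
    rw [this, sq]
    exact Nat.sub_le _ _
  rw [h1]
  calc _ ≤ (linesDetermined P).card * ∑ l ∈ linesDetermined P, (pointsOn P l).card ^ 2 :=
        sq_sum_le_card_mul_sum_sq
    _ ≤ (linesDetermined P).card * (2 * P.card ^ 2) := Nat.mul_le_mul_left _ h2
    _ = _ := by ring

open Finset in
/-- Some line determined by `P` contains many points of `P` through each of which pass few lines
determined by `P`. -/
theorem exists_line_many_points_small_degree (P : Finset (F × F)) (hP : 4 ≤ P.card) :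
    ∃ l ∈ linesDetermined P, ∃ S ⊆ pointsOn P l,
      P.card ^ 2 ≤ 16 * (linesDetermined P).card * S.card ^ 2 ∧
      ∀ x ∈ S, lineDegree P x ^ 2 ≤ 16 * (linesDetermined P).card := by
  classical
  set L := linesDetermined P with hL
  have hLpos : 0 < L.card := by
    obtain ⟨x, hx, y, hy, hxy⟩ := one_lt_card.1 (by omega : 1 < P.card)
    exact card_pos.2 ⟨_, mem_linesDetermined.2 ⟨x, hx, y, hy, hxy, rfl⟩⟩
  set P₀ := P.filter fun x => lineDegree P x ^ 2 ≤ 16 * L.card with hP₀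
  -- The degrees sum to at most √(2L) N, so fewer than half of the points have degree above 4√L.
  have hhalf : P.card ≤ 2 * P₀.card := by
    have h1 := sq_sum_lineDegree_le P
    set Q := P.filter fun x => ¬ lineDegree P x ^ 2 ≤ 16 * L.card with hQ
    have h2 : P₀.card + Q.card = P.card := card_filter_add_card_filter_not _
    have h3 : (Q.card : ℝ) * (4 * √(L.card : ℝ)) ≤ ((∑ x ∈ P, lineDegree P x : ℕ) : ℝ) := by
      push_cast
      calc (Q.card : ℝ) * (4 * √(L.card : ℝ)) = ∑ x ∈ Q, 4 * √(L.card : ℝ) := by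
            rw [sum_const, nsmul_eq_mul]
        _ ≤ ∑ x ∈ Q, (lineDegree P x : ℝ) := by
            refine sum_le_sum fun x hx => ?_
            have h4 := not_le.1 (mem_filter.1 hx).2
            refine le_of_sq_le_sq ?_ (by positivity)
            rw [mul_pow, Real.sq_sqrt (by positivity)]
            have : ((16 * L.card : ℕ) : ℝ) ≤ ((lineDegree P x ^ 2 : ℕ) : ℝ) := by
              exact_mod_cast h4.le
            push_cast at this
            linarith
        _ ≤ ∑ x ∈ P, (lineDegree P x : ℝ) :=
            sum_le_sum_of_subset_of_nonneg (filter_subset _ _) fun _ _ _ => by positivity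
    have h5 : ((Q.card : ℝ) * (4 * √(L.card : ℝ))) ^ 2 ≤ 2 * L.card * (P.card : ℝ) ^ 2 := by
      refine (pow_le_pow_left₀ (by positivity) h3 2).trans ?_
      exact_mod_cast h1
    rw [mul_pow, mul_pow, Real.sq_sqrt (by positivity)] at h5
    have h6 : (2 * Q.card) ^ 2 ≤ P.card ^ 2 := by
      have h7 : (0 : ℝ) < L.card := by exact_mod_cast hLpos
      have h8 : (2 * (Q.card : ℝ)) ^ 2 ≤ (P.card : ℝ) ^ 2 := by
        refine le_of_mul_le_mul_left ?_ h7
        nlinarith [sq_nonneg (Q.card : ℝ), mul_nonneg h7.le (sq_nonneg (Q.card : ℝ))]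
      exact_mod_cast h8
    have := (Nat.pow_le_pow_iff_left two_ne_zero).1 h6
    omega
  obtain ⟨l, hl, hlmax⟩ := exists_max_image L (fun l => (pointsOn P₀ l).card)
    (card_pos.1 hLpos)
  have hsub : P₀ ⊆ P := filter_subset _ _
  refine ⟨l, hl, pointsOn P₀ l, fun x hx => ?_, ?_, fun x hx => ?_⟩
  · rw [mem_pointsOn] at hx ⊢
    exact ⟨hsub hx.1, hx.2⟩
  · have h1 : P₀.card * (P₀.card - 1) ≤ L.card * (pointsOn P₀ l).card ^ 2 := by
      have h2 := sum_card_offDiag_pointsOn hsub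
      have h3 : ∑ l' ∈ L, (pointsOn P₀ l').offDiag.card ≤ ∑ l' ∈ L, (pointsOn P₀ l).card ^ 2 := by
        refine sum_le_sum fun l' hl' => ?_
        rw [offDiag_card, sq]
        exact (Nat.sub_le _ _).trans (Nat.mul_le_mul (hlmax l' hl') (hlmax l' hl'))
      rw [sum_const, smul_eq_mul] at h3
      rw [Nat.mul_sub_one]
      calc _ = P₀.offDiag.card := (offDiag_card _).symm
        _ ≤ _ := by rw [← h2]; convert h3
    obtain ⟨k, hk⟩ : ∃ k, P₀.card = k + 1 := ⟨P₀.card - 1, by omega⟩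
    rw [hk] at h1 hhalf
    simp only [Nat.add_succ_sub_one, add_zero] at h1
    nlinarith
  · exact (mem_filter.1 (mem_pointsOn.1 hx).1).2

end Incidence

/-! ### Projection to a graph with few sums -/

/-- Projective coordinates sending the line through `a` and `b` to infinity: the lines through a
point `r` on it become the level sets of `v - d r * u`. -/
theorem exists_coordinates_line_at_infinity {F : Type*} [Field F] {a b : F × F} (hab : a ≠ b) :
    ∃ u v d : F × F → F, Set.InjOn d (affineSpan F {a, b}) ∧
      Set.InjOn (fun x => (u x, v x)) {x | x ∉ affineSpan F {a, b}} ∧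
      ∀ r ∈ affineSpan F {a, b}, ∀ x, x ∉ affineSpan F {a, b} → ∀ y,
        y ∉ affineSpan F {a, b} → affineSpan F {r, x} = affineSpan F {r, y} →
          v x - d r * u x = v y - d r * u y := by
  obtain ⟨a₁, a₂⟩ := a
  obtain ⟨b₁, b₂⟩ := b
  set w₁ := b₁ - a₁ with hw₁
  set w₂ := b₂ - a₂ with hw₂
  obtain ⟨g₁, g₂, hg⟩ : ∃ g₁ g₂ : F, g₁ * w₁ + g₂ * w₂ = 1 := by
    by_cases h : w₁ = 0
    · have h2 : w₂ ≠ 0 := by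
        intro h2
        exact hab (Prod.ext (sub_eq_zero.1 h).symm (sub_eq_zero.1 h2).symm)
      exact ⟨0, w₂⁻¹, by rw [zero_mul, zero_add, inv_mul_cancel₀ h2]⟩
    · exact ⟨w₁⁻¹, 0, by rw [zero_mul, add_zero, inv_mul_cancel₀ h]⟩
  -- The function t vanishes exactly on the line and d is a coordinate along it. In the chart (1/t,
  -- d/t), a line through r with t r = 0 has (d x - d r)/t x constant.
  set t : F × F → F := fun x => w₁ * (x.2 - a₂) - w₂ * (x.1 - a₁) with ht
  set d : F × F → F := fun x => g₁ * (x.1 - a₁) + g₂ * (x.2 - a₂) with hd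
  have hx1 (x : F × F) : x.1 = a₁ + d x * w₁ - t x * g₂ := by
    simp only [hd, ht]; linear_combination (a₁ - x.1) * hg
  have hx2 (x : F × F) : x.2 = a₂ + d x * w₂ + t x * g₁ := by
    simp only [hd, ht]; linear_combination (a₂ - x.2) * hg
  have hmem (x : F × F) : x ∈ affineSpan F {((a₁, a₂) : F × F), (b₁, b₂)} ↔ t x = 0 := by
    rw [mem_affineSpan_pair_iff_exists_lineMap_eq]
    constructor
    · rintro ⟨c, rfl⟩
      simp only [ht, AffineMap.lineMap_apply, vsub_eq_sub, vadd_eq_add, Prod.mk_sub_mk,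
        Prod.smul_mk, Prod.mk_add_mk, smul_eq_mul]
      rw [← hw₁, ← hw₂]; ring
    · intro h
      refine ⟨d x, ?_⟩
      rw [AffineMap.lineMap_apply]
      simp only [vsub_eq_sub, vadd_eq_add, Prod.mk_sub_mk, Prod.smul_mk, Prod.mk_add_mk,
        smul_eq_mul]
      refine Prod.ext ?_ ?_
      · rw [hx1 x, h, ← hw₁]; ring
      · rw [hx2 x, h, ← hw₂]; ring
  refine ⟨fun x => 1 / t x, fun x => d x / t x, d, ?_, ?_, ?_⟩
  · intro x hx y hy h
    have htx := (hmem x).1 hx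
    have hty := (hmem y).1 hy
    refine Prod.ext ?_ ?_
    · rw [hx1 x, hx1 y, h, htx, hty]
    · rw [hx2 x, hx2 y, h, htx, hty]
  · intro x hx y hy h
    have htx : t x ≠ 0 := fun h => hx ((hmem x).2 h)
    have hty : t y ≠ 0 := fun h => hy ((hmem y).2 h)
    rw [Prod.mk.injEq] at h
    have e1 : t x = t y := by simpa using h.1
    have e2 : d x = d y := by
      have : d x / t x = d y / t y := h.2
      rw [e1] at this
      exact (div_left_inj' hty).1 this
    refine Prod.ext ?_ ?_
    · rw [hx1 x, hx1 y, e1, e2]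
    · rw [hx2 x, hx2 y, e1, e2]
  · intro r hr x hx y hy h
    have htr : t r = 0 := (hmem r).1 hr
    have htx : t x ≠ 0 := fun h => hx ((hmem x).2 h)
    have hty : t y ≠ 0 := fun h => hy ((hmem y).2 h)
    have hyl : y ∈ affineSpan F {r, x} := h ▸ right_mem_affineSpan_pair _ _ _
    obtain ⟨c, hc⟩ := mem_affineSpan_pair_iff_exists_lineMap_eq.1 hyl
    rw [AffineMap.lineMap_apply] at hc
    have hc1 : y.1 = c * (x.1 - r.1) + r.1 := by rw [← hc]; simp
    have hc2 : y.2 = c * (x.2 - r.2) + r.2 := by rw [← hc]; simp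
    have hty' : t y = c * t x := by
      have : t y = c * t x + (1 - c) * t r := by simp only [ht, hc1, hc2]; ring
      rw [this, htr, mul_zero, add_zero]
    have hdy : d y = c * d x + (1 - c) * d r := by simp only [hd, hc1, hc2]; ring
    have hc0 : c ≠ 0 := by
      rintro rfl
      exact hty (by rw [hty', zero_mul])
    simp only [hty', hdy]
    field_simp
    ring

open Finset in
/-- A map that is constant on the pencil of lines through `r` takes at most `lineDegree P r`
values on `G`. -/
theorem card_image_le_lineDegree {F τ : Type*} [Field F] [DecidableEq τ] {P G : Finset (F × F)}
    (hG : G ⊆ P) {r : F × F} (hr : r ∈ P) (hrG : r ∉ G) (f : F × F → τ)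
    (hf : ∀ x ∈ G, ∀ y ∈ G, affineSpan F {r, x} = affineSpan F {r, y} → f x = f y) :
    (G.image f).card ≤ lineDegree P r := by
  classical
  have hex : ∀ z, ∃ x, z ∈ G.image f → x ∈ G ∧ f x = z := by
    intro z
    by_cases hz : z ∈ G.image f
    · obtain ⟨x, hx, rfl⟩ := mem_image.1 hz
      exact ⟨x, fun _ => ⟨hx, rfl⟩⟩
    · exact ⟨0, fun h => (hz h).elim⟩
  choose x hx using hex
  refine card_le_card_of_injOn (fun z => affineSpan F {r, x z}) ?_ ?_
  · intro z hz
    refine mem_coe.2 (mem_filter.2 ⟨mem_linesDetermined.2 ⟨r, hr, x z, hG (hx z hz).1, ?_, rfl⟩,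
      left_mem_affineSpan_pair _ _ _⟩)
    intro h
    exact hrG (h ▸ (hx z hz).1)
  · intro z hz z' hz' h
    rw [← (hx z hz).2, ← (hx z' hz').2]
    exact hf _ (hx z hz).1 _ (hx z' hz').1 h

open Finset in
/-- A point set without rich lines projects to a dense graph with few sums along many slopes. -/
theorem exists_graph_few_sums {p : ℕ} [Fact p.Prime] (P : Finset (ZMod p × ZMod p))
    (hline : ∀ l ∈ linesDetermined P, 2 * (pointsOn P l).card < P.card) (s : ℝ) (hs0 : 0 < s)
    (hs2 : s ^ 2 = (linesDetermined P).card) (hlarge : 16 * s < P.card) (hP4 : 4 ≤ P.card) :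
    ∃ (G : Finset (ZMod p × ZMod p)) (Λ : Finset (ZMod p)), (P.card : ℝ) ≤ 2 * G.card ∧
      (P.card : ℝ) ≤ 4 * s * (Λ.card + 2) ∧ 0 ∉ Λ ∧ ((G.image Prod.fst).card : ℝ) ≤ 4 * s ∧
      ((G.image Prod.snd).card : ℝ) ≤ 4 * s ∧
      ∀ c ∈ Λ, ((G.image fun x => x.1 + c * x.2).card : ℝ) ≤ 4 * s := by
  set N : ℝ := (P.card : ℝ) with hN
  obtain ⟨l, hl, S, hSl, hScard, hSdeg⟩ := exists_line_many_points_small_degree P hP4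
  have hdeg (r : ZMod p × ZMod p) (hr : r ∈ S) : (lineDegree P r : ℝ) ≤ 4 * s := by
    refine le_of_sq_le_sq ?_ (by positivity)
    rw [mul_pow, hs2]
    have : ((lineDegree P r ^ 2 : ℕ) : ℝ) ≤ ((16 * (linesDetermined P).card : ℕ) : ℝ) :=
      Nat.cast_le.2 (hSdeg r hr)
    push_cast at this
    linarith
  have hSN : N ≤ 4 * s * S.card := by
    refine le_of_sq_le_sq ?_ (by positivity)
    rw [mul_pow, mul_pow, hs2]
    have : ((P.card ^ 2 : ℕ) : ℝ)
        ≤ ((16 * (linesDetermined P).card * S.card ^ 2 : ℕ) : ℝ) := Nat.cast_le.2 hScard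
    push_cast at this
    linarith
  have hS4 : 4 < S.card := by
    have : (4 : ℝ) < S.card := by
      refine lt_of_mul_lt_mul_left (?_ : 4 * s * 4 < 4 * s * S.card) (by positivity)
      linarith
    exact_mod_cast this
  obtain ⟨r₀, hr₀, r₁, hr₁, hr₀₁⟩ := one_lt_card.1 (by omega : 1 < S.card)
  obtain ⟨a, -, b, -, hab, rfl⟩ := mem_linesDetermined.1 hl
  obtain ⟨u, v, d, hd, huv, hpencil⟩ := exists_coordinates_line_at_infinity hab
  have hSmem (r : ZMod p × ZMod p) (hr : r ∈ S) : r ∈ affineSpan (ZMod p) {a, b} :=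
    (mem_pointsOn.1 (hSl hr)).2
  have hSP (r : ZMod p × ZMod p) (hr : r ∈ S) : r ∈ P := (mem_pointsOn.1 (hSl hr)).1
  have hdinj (r : ZMod p × ZMod p) (hr : r ∈ S) (r' : ZMod p × ZMod p) (hr' : r' ∈ S)
      (h : r ≠ r') : d r - d r' ≠ 0 :=
    sub_ne_zero.2 fun h' => h (hd (hSmem r hr) (hSmem r' hr') h')
  set G := P \ pointsOn P (affineSpan (ZMod p) {a, b}) with hG
  have hGmem (x : ZMod p × ZMod p) (hx : x ∈ G) : x ∉ affineSpan (ZMod p) {a, b} := fun h =>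
    (mem_sdiff.1 hx).2 (mem_pointsOn.2 ⟨(mem_sdiff.1 hx).1, h⟩)
  have hvalues (r : ZMod p × ZMod p) (hr : r ∈ S) (f : ZMod p × ZMod p → ZMod p) (μ : ZMod p)
      (hf : ∀ x, f x = μ * (v x - d r * u x)) : ((G.image f).card : ℝ) ≤ 4 * s := by
    refine le_trans ?_ (hdeg r hr)
    rw [Nat.cast_le]
    refine card_image_le_lineDegree sdiff_subset (hSP r hr) (fun h => hGmem r h (hSmem r hr)) f
      fun x hx y hy h => ?_
    rw [hf, hf, hpencil r (hSmem r hr) x (hGmem x hx) y (hGmem y hy) h]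
  set G' := G.image fun x => (v x - d r₀ * u x, v x - d r₁ * u x) with hG'
  have hG'card : G'.card = G.card := by
    refine card_image_of_injOn fun x hx y hy h => huv (hGmem x hx) (hGmem y hy) ?_
    rw [Prod.mk.injEq] at h
    have hu : u x = u y := mul_left_cancel₀ (hdinj r₁ hr₁ r₀ hr₀ hr₀₁.symm)
      (by linear_combination h.1 - h.2)
    have hv : v x = v y := by linear_combination h.1 + d r₀ * hu
    exact Prod.ext hu hv
  have hGhalf : N ≤ 2 * (G'.card : ℝ) := by
    have h1 := hline _ hl
    have h2 : G.card + (pointsOn P (affineSpan (ZMod p) {a, b})).card = P.card :=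
      card_sdiff_add_card_eq_card fun x hx => (mem_pointsOn.1 hx).1
    rw [hN, hG'card]
    have : P.card ≤ 2 * G.card := by omega
    exact_mod_cast this
  set S' := (S.erase r₀).erase r₁ with hS'
  have hS'card : S'.card = S.card - 2 := by
    rw [hS', card_erase_of_mem (mem_erase.2 ⟨hr₀₁.symm, hr₁⟩), card_erase_of_mem hr₀]
    omega
  have hS'mem (r : ZMod p × ZMod p) (hr : r ∈ S') : r ∈ S ∧ r ≠ r₀ ∧ r ≠ r₁ :=
    ⟨mem_of_mem_erase (mem_of_mem_erase hr), (mem_erase.1 (mem_of_mem_erase hr)).1,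
      (mem_erase.1 hr).1⟩
  -- With this c, (v - d r₀ u) + c (v - d r₁ u) is a multiple of v - d r u, so it is constant on
  -- lines through r. The poles r₀ and r₁ would give c = 0 and c = ∞, hence their removal.
  set Λ₀ := S'.image fun r => (d r - d r₀) / (d r₁ - d r) with hΛ₀
  have hΛ₀card : Λ₀.card = S.card - 2 := by
    rw [← hS'card]
    refine card_image_of_injOn fun r hr r' hr' h => ?_
    obtain ⟨h1, h2, h3⟩ := hS'mem r hr
    obtain ⟨h1', h2', h3'⟩ := hS'mem r' hr'
    rw [div_eq_div_iff (hdinj r₁ hr₁ r h1 h3.symm) (hdinj r₁ hr₁ r' h1' h3'.symm)] at h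
    refine hd (hSmem r h1) (hSmem r' h1') ?_
    exact mul_left_cancel₀ (hdinj r₁ hr₁ r₀ hr₀ hr₀₁.symm) (by linear_combination h)
  have hsum (c : ZMod p) (hc : c ∈ Λ₀) :
      ((G'.image fun x => x.1 + c * x.2).card : ℝ) ≤ 4 * s := by
    obtain ⟨r, hr, rfl⟩ := mem_image.1 hc
    obtain ⟨h1, h2, h3⟩ := hS'mem r hr
    have hne := hdinj r₁ hr₁ r h1 h3.symm
    rw [hG', image_image]
    refine hvalues r h1 _ ((d r₁ - d r₀) / (d r₁ - d r)) fun x => ?_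
    simp only [Function.comp_apply]
    field_simp
    ring
  have hfst : ((G'.image Prod.fst).card : ℝ) ≤ 4 * s := by
    rw [hG', image_image]
    exact hvalues r₀ hr₀ _ 1 fun x => (one_mul _).symm
  have hsnd : ((G'.image Prod.snd).card : ℝ) ≤ 4 * s := by
    rw [hG', image_image]
    exact hvalues r₁ hr₁ _ 1 fun x => (one_mul _).symm
  have hzero : (0 : ZMod p) ∉ Λ₀ := by
    intro h
    obtain ⟨r, hr, h⟩ := mem_image.1 h
    obtain ⟨h1, h2, h3⟩ := hS'mem r hr
    exact div_ne_zero (hdinj r h1 r₀ hr₀ h2) (hdinj r₁ hr₁ r h1 h3.symm) h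
  refine ⟨G', Λ₀, hGhalf, ?_, hzero, hfst, hsnd, hsum⟩
  have : Λ₀.card + 2 = S.card := by omega
  have : (Λ₀.card : ℝ) + 2 = S.card := by exact_mod_cast this
  rw [this]
  exact hSN

/-! ### Assembling the bound -/

open Finset in
/-- If no line contains half of the points of `P`, then `P` determines many lines. -/
theorem card_pow_le_card_linesDetermined {p : ℕ} [Fact p.Prime] (P : Finset (ZMod p × ZMod p))
    (hP : 2 ≤ P.card) (hPp : P.card < p)
    (hline : ∀ l ∈ linesDetermined P, 2 * (pointsOn P l).card < P.card) :
    (P.card : ℝ) ^ 37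
      ≤ 2 ^ 43 * 4 ^ 73 * (2 ^ 14 * 32000000 ^ 4) * √((linesDetermined P).card : ℝ) ^ 73 := by
  set s : ℝ := √((linesDetermined P).card : ℝ) with hs
  have hLpos : 0 < (linesDetermined P).card := by
    obtain ⟨x, hx, y, hy, hxy⟩ := one_lt_card.1 (by omega : 1 < P.card)
    exact card_pos.2 ⟨_, mem_linesDetermined.2 ⟨x, hx, y, hy, hxy, rfl⟩⟩
  have hs1 : 1 ≤ s := Real.one_le_sqrt.2 (by exact_mod_cast hLpos)
  have hs0 : 0 < s := by linarith
  have hs2 : s ^ 2 = (linesDetermined P).card := Real.sq_sqrt (by positivity)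
  set N : ℝ := (P.card : ℝ) with hN
  have hN2 : 2 ≤ N := by rw [hN]; exact_mod_cast hP
  rcases le_or_gt N (16 * s) with hsmall | hlarge
  · calc N ^ 37 ≤ (16 * s) ^ 37 := by gcongr
      _ = 16 ^ 37 * s ^ 37 := by ring
      _ ≤ 2 ^ 43 * 4 ^ 73 * (2 ^ 14 * 32000000 ^ 4) * s ^ 73 := by
          refine mul_le_mul (by norm_num) (pow_le_pow_right₀ hs1 (by norm_num)) (by positivity)
            (by norm_num)
  have hP4 : 4 ≤ P.card := by
    have : (4 : ℝ) ≤ P.card := by linarith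
    exact_mod_cast this
  obtain ⟨G', Λ₀, hGhalf, hΛ₀, hzero, hfst, hsnd, hsum⟩ :=
    exists_graph_few_sums P hline s hs0 hs2 hlarge hP4
  have hNs : N ≤ 32 * s ^ 2 := by
    have h1 : (G'.card : ℝ) ≤ (G'.image Prod.fst).card * (G'.image Prod.snd).card := by
      rw [← Nat.cast_mul, ← card_product]
      exact_mod_cast card_le_card fun x hx =>
        mem_product.2 ⟨mem_image_of_mem _ hx, mem_image_of_mem _ hx⟩
    have h2 : (G'.card : ℝ) ≤ (4 * s) * (4 * s) :=
      h1.trans (mul_le_mul hfst hsnd (by positivity) (by positivity))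
    nlinarith
  -- Using 8 where N/(4s) is available absorbs the two deleted poles, and truncating `Λ₀` to k
  -- elements ensures k² ≤ N < p.
  set k := ⌊N / (8 * s)⌋₊ with hk
  have hk8 : (k : ℝ) ≤ N / (8 * s) := Nat.floor_le (by positivity)
  have hk2 : 2 ≤ k := by
    refine Nat.le_floor ?_
    rw [le_div_iff₀ (by positivity)]
    push_cast
    linarith
  have hk16 : N ≤ 16 * s * k := by
    have h1 : N / (8 * s) < k + 1 := Nat.lt_floor_add_one _
    rw [div_lt_iff₀ (by positivity)] at h1
    have h2 : (2 : ℝ) ≤ k := by exact_mod_cast hk2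
    nlinarith
  have hkN : (k : ℝ) * (8 * s) ≤ N := (le_div_iff₀ (by positivity)).1 hk8
  have hkΛ₀ : k ≤ Λ₀.card := by
    have h1 : (2 * k : ℝ) ≤ Λ₀.card + 2 := by
      refine le_of_mul_le_mul_left (?_ : 4 * s * (2 * k) ≤ 4 * s * (Λ₀.card + 2)) (by positivity)
      linarith
    have h2 : 2 * k ≤ Λ₀.card + 2 := by exact_mod_cast h1
    omega
  have hkp : k ^ 2 ≤ p := by
    have h1 : (k : ℝ) ^ 2 ≤ P.card := by
      refine le_of_mul_le_mul_right (?_ : (k : ℝ) ^ 2 * (64 * s ^ 2) ≤ N * (64 * s ^ 2))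
        (by positivity)
      calc (k : ℝ) ^ 2 * (64 * s ^ 2) = (k * (8 * s)) ^ 2 := by ring
        _ ≤ N ^ 2 := by gcongr
        _ = N * N := sq N
        _ ≤ N * (64 * s ^ 2) := by gcongr; nlinarith
    exact (by exact_mod_cast h1 : k ^ 2 ≤ P.card).trans hPp.le
  obtain ⟨Λ, hΛsub, hΛcard⟩ := exists_subset_card_eq hkΛ₀
  have hG'pos : (0 : ℝ) < G'.card := by linarith
  have hmain := card_pow_le_of_few_sums G' (card_pos.1 (by exact_mod_cast hG'pos)) Λ
    (fun h => hzero (hΛsub h)) (hΛcard ▸ hk2) (hΛcard ▸ hkp) (4 * s) (by positivity) hfst hsnd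
    fun c hc => hsum c (hΛsub hc)
  rw [hΛcard] at hmain
  rcases hmain with h | h
  · calc N ^ 37 ≤ (2 * (G'.card : ℝ)) ^ 37 := by gcongr
      _ = 2 ^ 37 * (G'.card : ℝ) ^ 37 := by ring
      _ ≤ 2 ^ 37 * (2 ^ 14 * 32000000 ^ 4 * (4 * s) ^ 73) := by gcongr
      _ = 2 ^ 37 * 4 ^ 73 * (2 ^ 14 * 32000000 ^ 4) * s ^ 73 := by ring
      _ ≤ _ := by gcongr <;> norm_num
  · calc N ^ 37 = N ^ 2 * N ^ 35 := by ring
      _ ≤ (16 * s * k) ^ 2 * (2 * (G'.card : ℝ)) ^ 35 := by gcongr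
      _ = 2 ^ 43 * s ^ 2 * ((k : ℝ) ^ 2 * (G'.card : ℝ) ^ 35) := by ring
      _ ≤ 2 ^ 43 * s ^ 2 * (2 ^ 14 * 32000000 ^ 4 * (4 * s) ^ 71) := by gcongr
      _ = 2 ^ 43 * 4 ^ 71 * (2 ^ 14 * 32000000 ^ 4) * s ^ 73 := by ring
      _ ≤ _ := by gcongr <;> norm_num

/-- **Beck's theorem over prime fields**, with exponent `1 + 1 / 73`: a set of fewer than `p`
points has half of its points on a line, or determines many lines. -/
theorem exists_line_or_card_pow_le : ∃ K : ℝ, 1 ≤ K ∧ ∀ (p : ℕ) [Fact p.Prime]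
    (P : Finset (ZMod p × ZMod p)), 2 ≤ P.card → P.card < p →
      (∃ l ∈ linesDetermined P, P.card ≤ 2 * (pointsOn P l).card) ∨
      (P.card : ℝ) ^ 74 ≤ K * ((linesDetermined P).card : ℝ) ^ 73 := by
  refine ⟨(2 ^ 43 * 4 ^ 73 * (2 ^ 14 * 32000000 ^ 4)) ^ 2, by norm_num, fun p _ P hP hPp => ?_⟩
  by_cases h : ∃ l ∈ linesDetermined P, P.card ≤ 2 * (pointsOn P l).card
  · exact Or.inl h
  · right
    push Not at h
    have h1 := card_pow_le_card_linesDetermined P hP hPp h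
    calc (P.card : ℝ) ^ 74 = ((P.card : ℝ) ^ 37) ^ 2 := by ring
      _ ≤ _ := pow_le_pow_left₀ (by positivity) h1 2
      _ = (2 ^ 43 * 4 ^ 73 * (2 ^ 14 * 32000000 ^ 4)) ^ 2
            * (√((linesDetermined P).card : ℝ) ^ 2) ^ 73 := by rw [mul_pow]; ring
      _ = _ := by rw [Real.sq_sqrt (by positivity)]

/-- The implicit constants `C` depend on `ε` alone, not on `p` or `P`. -/
theorem theorem4p2 :
    ∃ C : ℝ → ℝ, ∀ (p : ℕ) [Fact p.Prime] (P : Finset (ZMod p × ZMod p)), P.card < p →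
      (∃ l : AffineSubspace (ZMod p) (ZMod p × ZMod p), IsPlaneLine l ∧
        LesssimWith C (P.card : ℝ) ((pointsOn P l).card : ℝ)) ∨
      LesssimWith C ((P.card : ℝ) ^ (1 + 1 / 133 : ℝ)) ((linesDetermined P).card : ℝ) := by
  obtain ⟨K, hK1, hK⟩ := exists_line_or_card_pow_le
  have hK0 : (0 : ℝ) < K := by linarith
  -- A constant family suffices: the factor 2 serves the half-of-the-points case, K the other.
  refine ⟨fun _ => 2 * K, fun p _ P hPp => ?_⟩
  have hself (n : ℕ) (hn : 1 ≤ n) (ε : ℝ) (hε : 0 < ε) : (n : ℝ) ≤ (n : ℝ) ^ (1 + ε) :=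
    Real.self_le_rpow_of_one_le (by exact_mod_cast hn) (by linarith)
  -- With at most one point no line is determined, so the first alternative must hold; any line
  -- through the point will do.
  rcases Nat.lt_or_ge P.card 2 with hlt | hge
  · left
    obtain ⟨x, hx⟩ : ∃ x, P ⊆ {x} := by
      rcases Nat.eq_zero_or_pos P.card with h0 | h0
      · exact ⟨0, by simp [Finset.card_eq_zero.1 h0]⟩
      · obtain ⟨x, hx⟩ := Finset.card_eq_one.1 (by omega : P.card = 1)
        exact ⟨x, hx.le⟩
    have hne : x ≠ x + (1, 0) := by simp
    refine ⟨affineSpan (ZMod p) {x, x + (1, 0)}, isPlaneLine_affineSpan_pair hne,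
      fun ε hε => ?_⟩
    have hpts : pointsOn P (affineSpan (ZMod p) {x, x + (1, 0)}) = P := by
      ext y
      rw [mem_pointsOn, and_iff_left_iff_imp]
      intro hy
      rw [Finset.mem_singleton.1 (hx hy)]
      exact left_mem_affineSpan_pair _ _ _
    rw [hpts]
    rcases Nat.eq_zero_or_pos P.card with h0 | h0
    · rw [h0, Nat.cast_zero]; positivity
    · have := hself P.card h0 ε hε
      nlinarith [Real.rpow_nonneg (Nat.cast_nonneg P.card : (0 : ℝ) ≤ P.card) (1 + ε)]
  · rcases hK p P hge hPp with ⟨l, hl, h⟩ | h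
    · left
      refine ⟨l, isPlaneLine_of_mem_linesDetermined hl, fun ε hε => ?_⟩
      have h1 := hself _ (le_trans (by norm_num) (two_le_card_pointsOn hl)) ε hε
      have h2 : (P.card : ℝ) ≤ 2 * (pointsOn P l).card := by exact_mod_cast h
      calc (P.card : ℝ) ≤ 2 * ((pointsOn P l).card : ℝ) ^ (1 + ε) := by linarith
        _ ≤ 2 * K * ((pointsOn P l).card : ℝ) ^ (1 + ε) := by gcongr; linarith
    · right
      intro ε hε
      have hL : 1 ≤ (linesDetermined P).card := by
        by_contra h0
        have h0 : (linesDetermined P).card = 0 := by omega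
        have : (0 : ℝ) < (P.card : ℝ) ^ 74 := by positivity
        rw [h0, Nat.cast_zero, zero_pow (by norm_num), mul_zero] at h
        linarith
      have hL' : (1 : ℝ) ≤ (linesDetermined P).card := by exact_mod_cast hL
      have hN1 : (1 : ℝ) ≤ P.card := by exact_mod_cast (by omega : 1 ≤ P.card)
      have h1 := hself _ hL ε hε
      have h2 : (P.card : ℝ) ^ (1 + 1 / 133 : ℝ) ≤ K * (linesDetermined P).card := by
        refine le_of_pow_le_pow_left₀ (n := 73) (by norm_num) (by positivity) ?_
        calc ((P.card : ℝ) ^ (1 + 1 / 133 : ℝ)) ^ 73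
            ≤ ((P.card : ℝ) ^ (74 / 73 : ℝ)) ^ 73 := by
              gcongr
              norm_num
          _ = (P.card : ℝ) ^ 74 := by
              rw [← Real.rpow_natCast, ← Real.rpow_mul (by positivity), ← Real.rpow_natCast]
              norm_num
          _ ≤ K * ((linesDetermined P).card : ℝ) ^ 73 := h
          _ ≤ K ^ 73 * ((linesDetermined P).card : ℝ) ^ 73 := by
              gcongr
              exact le_self_pow₀ hK1 (by norm_num)
          _ = _ := (mul_pow _ _ _).symm
      calc (P.card : ℝ) ^ (1 + 1 / 133 : ℝ) ≤ K * (linesDetermined P).card := h2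
        _ ≤ K * ((linesDetermined P).card : ℝ) ^ (1 + ε) := by gcongr
        _ ≤ 2 * K * ((linesDetermined P).card : ℝ) ^ (1 + ε) := by gcongr; linarith
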